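/- Let $d\ge 1$, let $A=(a_1,\dots,a_n)$ be a configuration of $n$ points in $\mathbb R^d$, labelled by $[n]$, that affinely spans $\mathbb R^d$, and let $k\in[d]=\{1,\dots,d\}$. For $J\subseteq[n]$ let $A_J$ be the subconfiguration labelled by $J$, let $$\Delta_J^{(k)}=\operatorname{conv}\Big\{\sum_{i\in B}e_i : B\subseteq J,\ |B|=k\Big\}\subset\mathbb R^J\subseteq\mathbb R^n$$ be the $k$-th hypersimplex on $J$, and let $\pi:\mathbb R^n\to\mathbb R^d$ be the linear map with $\pi(e_i)=a_i$. A fine $\pi$-induced subdivision of the image of a polytope $Q$ is given by a set $T$ of nonempty faces of $Q$, closed under taking nonempty faces, such that $\pi$ maps $\bigcup_{G\in T}G$ bijectively onto $\pi(Q)$; its GKZ vector is $$\operatorname{GKZ}(T)=\sum_{G\in T}\frac{\operatorname{vol}(\pi(G))}{\operatorname{vol}(\pi(Q))}\,\mathbf c(G),$$ where $\operatorname{vol}$ is the volume in the affine hull of $\pi(Q)$ and $\mathbf c(G)$ is the centroid of $G$. The $k$-th hypersecondary polytope $\mathcal F^{(k)}(A_J)\subset\mathbb R^n$ is the convex hull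 of the vectors $\operatorname{GKZ}(T)$ of all fine $\pi$-induced subdivisions $T$ for $Q=\Delta_J^{(k)}$; that is, it is the fiber polytope of $\pi:\Delta_J^{(k)}\to\pi(\Delta_J^{(k)})$. Write $\mathcal F^{(k)}(A)=\mathcal F^{(k)}(A_{[n]})$. Two polytopes $P,Q\subset\mathbb R^n$ are normally equivalent, $P\cong Q$, if the normal fan of each refines the normal fan of the other. Then: 1. if $n>d+2$, then $\displaystyle \mathcal F^{(k+1)}(A)\cong\sum_{i\in[n]}\mathcal F^{(k)}(A_{[n]\setminus i})$; 2. for every $n$, $\displaystyle \mathcal F^{(k+1)}(A)\cong\mathcal F^{(k)}(A)+\sum_{i\in[n]}\mathcal F^{(k)}(A_{[n]\setminus i})$, where the sums are Minkowski sums. -/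

import Mathlib

open MeasureTheory
open scoped Pointwise

noncomputable section

namespace HyperSec

section Polytopes

variable {E : Type*} [AddCommGroup E] [Module ℝ E]

/-- The face `P^w` of `P` selected by the linear functional `w`: the points of `P` where `w`
attains its minimum over `P`. -/
def faceOf (P : Set E) (w : Module.Dual ℝ E) : Set E :=
  {x | x ∈ P ∧ ∀ y ∈ P, w x ≤ w y}

/-- `G` is a (nonempty, if `P` is a nonempty polytope) face of `P`; `P` itself is the face
selected by `w = 0`. -/
def IsFace (P G : Set E) : Prop :=
  ∃ w : Module.Dual ℝ E, G = faceOf P w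

/-- The (closed) normal cone of `P` along `G`: all functionals that are minimized over `P` at every
point of `G`. -/
def normalCone (P G : Set E) : Set (Module.Dual ℝ E) :=
  {w | ∀ x ∈ G, ∀ y ∈ P, w x ≤ w y}

/-- The normal fan of `P`: the collection of the normal cones of all its faces. -/
def normalFan (P : Set E) : Set (Set (Module.Dual ℝ E)) :=
  {C | ∃ G, IsFace P G ∧ C = normalCone P G}

/-- The fan `𝒞` refines the fan `𝒟`: every cone of `𝒞` is contained in a cone of `𝒟`. -/
def FanRefines (𝒞 𝒟 : Set (Set (Module.Dual ℝ E))) : Prop :=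
  ∀ C ∈ 𝒞, ∃ D ∈ 𝒟, C ⊆ D

/-- `Q ≤ P`: the normal fan of `P` refines the normal fan of `Q`. -/
def IsMinkowskiSummand (Q P : Set E) : Prop :=
  FanRefines (normalFan P) (normalFan Q)

/-- `P ≅ Q`: each of the two polytopes is a Minkowski summand of the other. -/
def NormallyEquivalent (P Q : Set E) : Prop :=
  IsMinkowskiSummand P Q ∧ IsMinkowskiSummand Q P

/-- The dimension of (the affine hull of) a set. -/
def affineDim (S : Set E) : ℕ :=
  Module.finrank ℝ (vectorSpan ℝ S)

end Polytopes

section FiberPolytope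

variable {E F : Type*}
  [NormedAddCommGroup E] [NormedSpace ℝ E] [MeasurableSpace E] [BorelSpace E]
  [NormedAddCommGroup F] [NormedSpace ℝ F] [MeasurableSpace F] [BorelSpace F]

/-- A fine `π`-induced subdivision of `π(Q)`, recorded through the faces of `Q` that project to its
cells: a subcomplex `T` of the face complex of `Q` that is a section of `π : Q → π(Q)`, that is,
`π` maps the union of the faces in `T` bijectively onto `π(Q)`. -/
structure IsFineSubdivision (π : E →ₗ[ℝ] F) (Q : Set E) (T : Set (Set E)) : Prop where
  isFace : ∀ G ∈ T, IsFace Q G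
  face_mem : ∀ G ∈ T, ∀ H, IsFace G H → H ∈ T
  bijOn : Set.BijOn π (⋃₀ T) (π '' Q)

/-- The centroid of `G` (with respect to the volume of the affine hull of `G`, given here by the
Hausdorff measure of dimension `dim G`). -/
def centroid (G : Set E) : E :=
  ⨍ x in G, x ∂(μH[(affineDim G : ℝ)] : Measure E)

/-- The volume of a subset of `F` in dimension `r`. -/
def vol (r : ℕ) (S : Set F) : ℝ :=
  (μH[(r : ℝ)] : Measure F).real S

/-- The vector `GKZ(T) = ∑_{G ∈ T} vol(π(G)) / vol(π(Q)) • c(G)`, the volumes being taken in the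
affine hull of `π(Q)` (so that only the cells of full dimension contribute). -/
def gkz (π : E →ₗ[ℝ] F) (Q : Set E) (T : Set (Set E)) : E :=
  ∑ᶠ G ∈ T,
    (vol (affineDim (π '' Q)) (π '' G) / vol (affineDim (π '' Q)) (π '' Q)) • centroid G

/-- The fiber polytope of the projection `π : Q → π(Q)`: the convex hull of the vectors `GKZ(T)`
of all fine `π`-induced subdivisions `T`. -/
def fiberPolytope (π : E →ₗ[ℝ] F) (Q : Set E) : Set E :=
  convexHull ℝ {g | ∃ T, IsFineSubdivision π Q T ∧ g = gkz π Q T}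

end FiberPolytope

/-- The `k`-th hypersimplex on the labels in `J ⊆ [n]`, as a subset of `ℝ^J ⊆ ℝ^n`: the convex hull
of the points `∑_{i ∈ B} e_i` over all `k`-element subsets `B` of `J`. -/
def hypersimplex {n : ℕ} (J : Finset (Fin n)) (k : ℕ) : Set (EuclideanSpace ℝ (Fin n)) :=
  convexHull ℝ {x | ∃ B : Finset (Fin n), B ⊆ J ∧ B.card = k ∧
    x = ∑ i ∈ B, EuclideanSpace.single i (1 : ℝ)}

/-- The linear projection `π : ℝ^n → ℝ^d` with `π(e_i) = a_i`. -/
def proj {n d : ℕ} (a : Fin n → EuclideanSpace ℝ (Fin d)) :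
    EuclideanSpace ℝ (Fin n) →ₗ[ℝ] EuclideanSpace ℝ (Fin d) where
  toFun x := ∑ i, x i • a i
  map_add' x y := by simp [add_smul, Finset.sum_add_distrib]
  map_smul' c x := by simp [Finset.smul_sum, mul_smul]

/-- The `k`-th hypersecondary polytope `F^(k)(A_J)` of the subconfiguration `A_J` of
`A = (a_1, …, a_n)` with labels in `J`, as a polytope in `ℝ^J ⊆ ℝ^n`. -/
def hypersecondary {n d : ℕ} (a : Fin n → EuclideanSpace ℝ (Fin d)) (J : Finset (Fin n)) (k : ℕ) :
    Set (EuclideanSpace ℝ (Fin n)) :=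
  fiberPolytope (proj a) (hypersimplex J k)

end HyperSec

end

/-! Both equivalences compare preorders on functionals. For a polytope `P`, the inclusion `faceOf P
w ⊆ faceOf P u` says that `u` lies in the normal cone of the face selected by `w`, so one normal fan
refines another as soon as these inclusions transfer (`isMinkowskiSummand_of_faceOf_subset`). For a
Minkowski sum the relation is the conjunction over the summands (`faceOf_sum_subset_iff`).

A GKZ vector is the average of the section of `π` given by the subdivision (`gkz_eq`), so it
minimizes `w` exactly when that section minimizes `w` in every fiber. Face inclusions of a
hypersecondary polytope thus become `FiberDominates`: every fiberwise minimizer of `w` is one of `u`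
(`faceOf_hypersecondary_subset_iff`).

Minimizing over a fiber of a hypersimplex is a linear program with box constraints. Its multipliers
are functionals `p` on `ℝ^d × ℝ`, with reduced costs `height`: an optimal `x` is 1 at negative
heights and 0 at positive ones. Over a generic fiber the lifted points of height zero span, so `p`
is a vertex of the arrangement of the hyperplanes where one height vanishes, with fewer than `k`
negative and more than `k` nonpositive heights. For spanning `J`, `FiberDominates` therefore amounts
to sign compatibility at all these vertices (`exists_signCompatible`,
`isFiberMin_of_forall_signCompatible`).

The rest is counting. A vertex relevant at level `k + 1` has at most `k` negative heights. Deleting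
a negative label if there are exactly `k`, or a label off a basis of zero heights if there are
fewer, gives a vertex relevant at level `k` of the deletion. Either `n > d + 2` leaves enough labels
to delete, or level `k` of the whole configuration fills the gap (`FiberDominates.succ`).
Conversely, a vertex relevant at level `k` is relevant at level `k + 1`, except when `k = d` and
only a basis has nonpositive height; there a neighbouring vertex is used (`FiberDominates.of_succ`).
If deleting `i` destroys spanning, the fibers at level `k` are translates by `e_i` of fibers at
level `k + 1` (`FiberDominates.of_succ_erase_of_not_spanning`). -/

noncomputable section

namespace HyperSec

/-! ### Faces, Minkowski sums and perturbation of functionals. -/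

section Faces

variable {E : Type*} [AddCommGroup E] [Module ℝ E]

/-- If every inclusion of faces of `P` is inherited by `R`, then `R` is a Minkowski summand
of `P`. -/
theorem isMinkowskiSummand_of_faceOf_subset {P R : Set E}
    (h : ∀ w u : Module.Dual ℝ E, faceOf P w ⊆ faceOf P u → faceOf R w ⊆ faceOf R u) :
    IsMinkowskiSummand R P := by
  rintro C ⟨G, ⟨w, rfl⟩, rfl⟩
  -- Membership of `u` in the normal cone along `faceOf P w` is the same as `faceOf P w ⊆ faceOf P
  -- u`.
  refine ⟨normalCone R (faceOf R w), ⟨_, ⟨w, rfl⟩, rfl⟩, fun u hu x hx y hy => ?_⟩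
  exact (h w u (fun z hz => ⟨hz.1, hu z hz⟩) hx).2 y hy

/-- A sum is minimal exactly when both summands are. Nonemptiness supplies a fixed minimizer in one
summand, which isolates the condition on the other. -/
theorem faceOf_add_subset_iff {P R : Set E} {w u : Module.Dual ℝ E}
    (hP : (faceOf P w).Nonempty) (hR : (faceOf R w).Nonempty) :
    faceOf (P + R) w ⊆ faceOf (P + R) u ↔
      faceOf P w ⊆ faceOf P u ∧ faceOf R w ⊆ faceOf R u := by
  have key : ∀ (f : Module.Dual ℝ E) (p r : E), p ∈ faceOf P f → r ∈ faceOf R f →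
      p + r ∈ faceOf (P + R) f := by
    rintro f p r hp hr
    refine ⟨Set.add_mem_add hp.1 hr.1, ?_⟩
    rintro _ ⟨p', hp', r', hr', rfl⟩
    simpa using add_le_add (hp.2 p' hp') (hr.2 r' hr')
  have key' : ∀ (f : Module.Dual ℝ E) (p r : E), p ∈ P → r ∈ R →
      p + r ∈ faceOf (P + R) f → p ∈ faceOf P f ∧ r ∈ faceOf R f := by
    rintro f p r hp hr h
    refine ⟨⟨hp, fun q hq => ?_⟩, ⟨hr, fun q hq => ?_⟩⟩
    · simpa using h.2 (q + r) (Set.add_mem_add hq hr)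
    · simpa using h.2 (p + q) (Set.add_mem_add hp hq)
  constructor
  · intro h
    obtain ⟨p₀, hp₀⟩ := hP
    obtain ⟨r₀, hr₀⟩ := hR
    exact ⟨fun p hp => (key' u p r₀ hp.1 hr₀.1 (h (key w p r₀ hp hr₀))).1,
      fun r hr => (key' u p₀ r hp₀.1 hr.1 (h (key w p₀ r hp₀ hr))).2⟩
  · rintro ⟨h1, h2⟩ x hx
    obtain ⟨p, hp, r, hr, rfl⟩ := hx.1
    obtain ⟨hp', hr'⟩ := key' w p r hp hr hx
    exact key u p r (h1 hp') (h2 hr')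

theorem faceOf_add_nonempty {P R : Set E} {w : Module.Dual ℝ E}
    (hP : (faceOf P w).Nonempty) (hR : (faceOf R w).Nonempty) :
    (faceOf (P + R) w).Nonempty := by
  obtain ⟨p, hp⟩ := hP
  obtain ⟨r, hr⟩ := hR
  refine ⟨p + r, Set.add_mem_add hp.1 hr.1, ?_⟩
  rintro _ ⟨p', hp', r', hr', rfl⟩
  simpa using add_le_add (hp.2 p' hp') (hr.2 r' hr')

theorem faceOf_sum_subset_iff {ι : Type*} (s : Finset ι) (P : ι → Set E)
    (hP : ∀ i ∈ s, ∀ w : Module.Dual ℝ E, (faceOf (P i) w).Nonempty) (w : Module.Dual ℝ E) :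
    (faceOf (∑ i ∈ s, P i) w).Nonempty ∧ ∀ u : Module.Dual ℝ E,
      (faceOf (∑ i ∈ s, P i) w ⊆ faceOf (∑ i ∈ s, P i) u ↔
        ∀ i ∈ s, faceOf (P i) w ⊆ faceOf (P i) u) := by
  classical
  induction s using Finset.induction_on with
  | empty =>
    have h0 : ∀ f : Module.Dual ℝ E, faceOf (0 : Set E) f = 0 := by
      intro f
      ext x
      constructor
      · exact fun hx => hx.1
      · intro hx
        refine ⟨hx, fun y hy => ?_⟩
        rw [Set.mem_zero.1 hx, Set.mem_zero.1 hy]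
    simp [h0]
  | insert i s hi ih =>
    have ih := ih (fun j hj => hP j (Finset.mem_insert_of_mem hj))
    have hPi := hP i (Finset.mem_insert_self i s) w
    rw [Finset.sum_insert hi]
    refine ⟨faceOf_add_nonempty hPi ih.1, fun u => ?_⟩
    rw [faceOf_add_subset_iff hPi ih.1, ih.2 u, Finset.forall_mem_insert]

theorem faceOf_convex {P : Set E} (hP : Convex ℝ P) (w : Module.Dual ℝ E) :
    Convex ℝ (faceOf P w) := by
  intro x hx y hy a b ha hb hab
  refine ⟨hP hx.1 hy.1 ha hb hab, fun z hz => ?_⟩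
  have h1 := mul_le_mul_of_nonneg_left (hx.2 z hz) ha
  have h2 := mul_le_mul_of_nonneg_left (hy.2 z hz) hb
  have h3 : a * w z + b * w z = w z := by rw [← add_mul, hab, one_mul]
  simp only [map_add, map_smul, smul_eq_mul]
  linarith

/-- A common point attains the minimum of `g` over all of `P` already inside the `f`-face, so both
minima of `g` agree. -/
theorem faceOf_inter_faceOf {P : Set E} {f g : Module.Dual ℝ E}
    (h : (faceOf P f ∩ faceOf P g).Nonempty) :
    faceOf P f ∩ faceOf P g = faceOf (faceOf P f) g := by
  obtain ⟨x, hx⟩ := h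
  ext z
  constructor
  · exact fun hz => ⟨hz.1, fun y hy => hz.2.2 y hy.1⟩
  · exact fun hz => ⟨hz.1, hz.1.1, fun y hy => (hz.2 x hx.1).trans (hx.2.2 y hy)⟩

theorem isExtreme_faceOf (P : Set E) (w : Module.Dual ℝ E) : IsExtreme ℝ P (faceOf P w) := by
  refine ⟨fun x hx => hx.1, ?_⟩
  rintro x hx y hy z hz ⟨a, b, ha, hb, hab, rfl⟩
  refine ⟨hx, fun t ht => ?_⟩
  have h1 := hz.2 y hy
  have h2 := hz.2 t ht
  simp only [map_add, map_smul, smul_eq_mul] at h1 h2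
  have hb' : b = 1 - a := by linarith
  subst hb'
  have h3 : a * (w x - w y) ≤ 0 := by linarith
  have h4 : w x ≤ w y := by nlinarith
  nlinarith

/-- A polytope: the convex hull of a nonempty finite set. -/
def IsPolytope (P : Set E) : Prop :=
  ∃ V : Set E, V.Finite ∧ V.Nonempty ∧ P = convexHull ℝ V

theorem le_on_convexHull {V : Set E} {f : Module.Dual ℝ E} {m : ℝ} (h : ∀ v ∈ V, m ≤ f v) :
    ∀ x ∈ convexHull ℝ V, m ≤ f x := by
  intro x hx
  have : convexHull ℝ V ⊆ {x | m ≤ f x} :=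
    convexHull_min h (convex_halfSpace_ge f.isLinear m)
  exact this hx

theorem IsPolytope.faceOf_nonempty {P : Set E} (hP : IsPolytope P) (w : Module.Dual ℝ E) :
    (faceOf P w).Nonempty := by
  obtain ⟨V, hV, hne, rfl⟩ := hP
  obtain ⟨v, hv, hmin⟩ := hV.exists_minimalFor w V hne
  refine ⟨v, subset_convexHull ℝ V hv, le_on_convexHull fun u hu => ?_⟩
  rcases le_total (w v) (w u) with h | h
  · exact h
  · exact hmin hu h

theorem IsPolytope.convex {P : Set E} (hP : IsPolytope P) : Convex ℝ P := by
  obtain ⟨V, -, -, rfl⟩ := hP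
  exact convex_convexHull ℝ V

theorem IsPolytope.nonempty {P : Set E} (hP : IsPolytope P) : P.Nonempty := by
  obtain ⟨V, -, h, rfl⟩ := hP
  exact h.convexHull

/-- The face in direction `h` of the face in direction `g` is a face, selected by a small
perturbation of `g`. -/
theorem IsPolytope.exists_faceOf_faceOf {P : Set E} (hP : IsPolytope P)
    (g h : Module.Dual ℝ E) :
    ∃ ε : ℝ, 0 < ε ∧ faceOf P (g + ε • h) = faceOf (faceOf P g) h := by
  obtain ⟨V, hV, hne, rfl⟩ := hP
  obtain ⟨z, hz⟩ : (faceOf (faceOf (convexHull ℝ V) g) h).Nonempty := by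
    obtain ⟨v, hv, hmin⟩ : ∃ v ∈ V ∩ faceOf (convexHull ℝ V) g,
        ∀ u ∈ V ∩ faceOf (convexHull ℝ V) g, h v ≤ h u := by
      have hne' : (V ∩ faceOf (convexHull ℝ V) g).Nonempty := by
        obtain ⟨v, hv, hmin⟩ := hV.exists_minimalFor g V hne
        refine ⟨v, hv, subset_convexHull ℝ V hv, le_on_convexHull fun u hu => ?_⟩
        rcases le_total (g v) (g u) with h | h
        · exact h
        · exact hmin hu h
      obtain ⟨v, hv, hmin⟩ := (hV.inter_of_left _).exists_minimalFor h _ hne'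
      refine ⟨v, hv, fun u hu => ?_⟩
      rcases le_total (h v) (h u) with h' | h'
      · exact h'
      · exact hmin hu h'
    -- Generators off the `g`-face satisfy `g u > g v`, so a large multiple of `g` penalizes them
    -- enough. Then `h + M • g` is minimal at `v` over the whole hull, hence `h` is minimal at `v`
    -- on the `g`-face.
    obtain ⟨M, hM⟩ : ∃ M : ℝ, 0 ≤ M ∧ ∀ u ∈ V, h v ≤ h u + M * (g u - g v) := by
      have : ∀ u ∈ V, ∀ᶠ M : ℝ in Filter.atTop, h v ≤ h u + M * (g u - g v) := by
        intro u hu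
        have hgu := hv.2.2 u (subset_convexHull ℝ V hu)
        rcases hgu.eq_or_lt with he | hl
        · have : u ∈ faceOf (convexHull ℝ V) g :=
            ⟨subset_convexHull ℝ V hu, fun y hy => he ▸ hv.2.2 y hy⟩
          filter_upwards with M
          simpa [he] using hmin u ⟨hu, this⟩
        · have := (Filter.tendsto_id (x := (Filter.atTop : Filter ℝ))).atTop_mul_const
            (sub_pos.2 hl)
          filter_upwards [this.eventually_ge_atTop (h v - h u)] with M hM
          simp only [id] at hM
          linarith
      obtain ⟨M, h1, h2⟩ := (((hV.eventually_all (l := Filter.atTop)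
        (p := fun u (M : ℝ) => h v ≤ h u + M * (g u - g v))).2 this).and
          (Filter.eventually_ge_atTop 0)).exists
      exact ⟨M, h2, h1⟩
    refine ⟨v, hv.2, fun y hy => ?_⟩
    have : h v + M * g v ≤ (h + M • g) y := by
      refine le_on_convexHull (V := V) (fun u hu => ?_) y hy.1
      have := hM.2 u hu
      simp only [LinearMap.add_apply, LinearMap.smul_apply, smul_eq_mul]
      linarith
    have e : g y = g v := le_antisymm (hy.2 v hv.2.1) (hv.2.2 y hy.1)
    simp only [LinearMap.add_apply, LinearMap.smul_apply, smul_eq_mul, e] at this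
    linarith
  have hz1 : ∀ u ∈ V, g z ≤ g u := fun u hu => hz.1.2 u (subset_convexHull ℝ V hu)
  have hev : ∀ᶠ ε : ℝ in nhdsWithin 0 (Set.Ioi 0), ∀ u ∈ V, g z + ε * h z ≤ g u + ε * h u := by
    rw [hV.eventually_all]
    intro u hu
    rcases (hz1 u hu).eq_or_lt with he | hl
    · have hu' : u ∈ faceOf (convexHull ℝ V) g :=
        ⟨subset_convexHull ℝ V hu, fun y hy => he ▸ hz.1.2 y hy⟩
      filter_upwards [self_mem_nhdsWithin] with ε hε
      have := mul_le_mul_of_nonneg_left (hz.2 u hu') (le_of_lt hε)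
      linarith
    · have hc : Filter.Tendsto (fun ε : ℝ => g u + ε * h u - (g z + ε * h z))
          (nhds 0) (nhds (g u + 0 * h u - (g z + 0 * h z))) :=
        Continuous.tendsto (by fun_prop) 0
      have := hc.eventually (lt_mem_nhds (show (0 : ℝ) < _ by simpa using hl))
      filter_upwards [nhdsWithin_le_nhds this] with ε hε
      linarith
  obtain ⟨δ, hδ0, hδ⟩ := mem_nhdsGT_iff_exists_Ioo_subset.1 hev
  have hδ0 : 0 < δ := hδ0
  have main : ∀ ε : ℝ, 0 < ε → ε < δ → ∀ x ∈ convexHull ℝ V, g z + ε * h z ≤ g x + ε * h x := by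
    intro ε h0 h1 x hx
    have := le_on_convexHull (V := V) (f := g + ε • h) (m := g z + ε * h z)
      (fun u hu => by simpa using hδ ⟨h0, h1⟩ u hu) x hx
    simpa using this
  refine ⟨δ / 3, by positivity, ?_⟩
  ext x
  constructor
  · intro hx
    -- With `D = (δ/3)(h z - h x)` and `G = g x - g z ≥ 0`, optimality of `x` at `δ/3` gives `G ≤ D`
    -- and optimality of `z` at `2δ/3` gives `2D ≤ G`; hence `D = G = 0`.
    have h1 := hx.2 z hz.1.1
    have h2 := main (2 * δ / 3) (by linarith) (by linarith) x hx.1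
    have h3 := hz.1.2 x hx.1
    simp only [LinearMap.add_apply, LinearMap.smul_apply, smul_eq_mul] at h1
    have h4 : g x = g z := by linarith
    have h5 : h x = h z := by
      rw [h4] at h1 h2
      have a1 : δ * h x ≤ δ * h z := by linarith
      have a2 : δ * h z ≤ δ * h x := by linarith
      exact mul_left_cancel₀ hδ0.ne' (le_antisymm a1 a2)
    exact ⟨⟨hx.1, fun y hy => h4 ▸ hz.1.2 y hy⟩, fun y hy => h5 ▸ hz.2 y hy⟩
  · intro hx
    have h4 : g x = g z := le_antisymm (hx.1.2 z hz.1.1) (hz.1.2 x hx.1.1)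
    have h5 : h x = h z := le_antisymm (hx.2 z hz.1) (hz.2 x hx.1)
    refine ⟨hx.1.1, fun y hy => ?_⟩
    have := main (δ / 3) (by linarith) (by linarith) y hy
    simpa [h4, h5] using this

end Faces

/-! ### Compactness and finiteness of faces. -/

section Polytopes

variable {E : Type*} [NormedAddCommGroup E] [NormedSpace ℝ E]

theorem IsPolytope.isCompact {P : Set E} (hP : IsPolytope P) : IsCompact P := by
  obtain ⟨V, hV, -, rfl⟩ := hP
  exact hV.isCompact_convexHull ℝ

variable [FiniteDimensional ℝ E]

theorem isClosed_faceOf {P : Set E} (hP : IsClosed P) (w : Module.Dual ℝ E) :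
    IsClosed (faceOf P w) := by
  have hw : Continuous w := w.continuous_of_finiteDimensional
  have : faceOf P w = P ∩ ⋂ y ∈ P, {x | w x ≤ w y} := by
    ext x; simp [faceOf]
  rw [this]
  exact hP.inter (isClosed_biInter fun y _ => isClosed_le hw continuous_const)

theorem isCompact_faceOf {P : Set E} (hP : IsCompact P) (w : Module.Dual ℝ E) :
    IsCompact (faceOf P w) :=
  hP.of_isClosed_subset (isClosed_faceOf hP.isClosed w) fun _ hx => hx.1

/-- A face is recovered from its extreme points, which are extreme in `P` and so belong to the
finite generating set. -/
theorem IsPolytope.finite_faces {P : Set E} (hP : IsPolytope P) : {G | IsFace P G}.Finite := by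
  obtain ⟨V, hV, hne, hPV⟩ := id hP
  refine (hV.finite_subsets.image fun S => closure (convexHull ℝ S)).subset ?_
  rintro _ ⟨w, rfl⟩
  refine ⟨(faceOf P w).extremePoints ℝ, ?_, closure_convexHull_extremePoints
    (isCompact_faceOf hP.isCompact w) (faceOf_convex hP.convex w)⟩
  have h1 := (isExtreme_faceOf P w).extremePoints_subset_extremePoints
  refine h1.trans ?_
  rw [hPV]
  exact extremePoints_convexHull_subset

end Polytopes

/-! ### Minimizers on fibers and multipliers. -/

section FiberMin

variable {E F : Type*} [AddCommGroup E] [Module ℝ E] [AddCommGroup F] [Module ℝ F]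

/-- `x` minimizes the functional `w` over the fiber of `π : Q → π(Q)` through `x`. -/
def IsFiberMin (π : E →ₗ[ℝ] F) (Q : Set E) (w : Module.Dual ℝ E) (x : E) : Prop :=
  x ∈ Q ∧ ∀ y ∈ Q, π y = π x → w x ≤ w y

theorem isFiberMin_of_mem_faceOf {π : E →ₗ[ℝ] F} {Q : Set E} {w : Module.Dual ℝ E}
    {ψ : Module.Dual ℝ F} {x : E} (hx : x ∈ faceOf Q (w + ψ ∘ₗ π)) : IsFiberMin π Q w x := by
  refine ⟨hx.1, fun y hy hxy => ?_⟩
  have := hx.2 y hy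
  simpa [hxy] using this

/-- Complementary slackness: one multiplier `ψ` serves all minimizers of the same fiber, since `ψ ∘
π` is constant there. -/
theorem IsFiberMin.mem_faceOf {π : E →ₗ[ℝ] F} {Q : Set E} {w : Module.Dual ℝ E}
    {ψ : Module.Dual ℝ F} {x y : E} (hx : IsFiberMin π Q w x) (hy : y ∈ faceOf Q (w + ψ ∘ₗ π))
    (hxy : π y = π x) : x ∈ faceOf Q (w + ψ ∘ₗ π) := by
  refine ⟨hx.1, fun z hz => le_trans ?_ (hy.2 z hz)⟩
  simpa [hxy] using hx.2 y hy.1 hxy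

/-- By convexity a sum of two nonnegatively scaled differences is again one: average the endpoints
with weights proportional to the scalars. -/
theorem exists_smul_sub_of_mem_vectorSpan {G : Set E} (hG : Convex ℝ G) {z : E}
    (hz : z ∈ vectorSpan ℝ G) (hne : G.Nonempty) :
    ∃ p ∈ G, ∃ q ∈ G, ∃ t : ℝ, z = t • (p - q) := by
  have key : ∀ z ∈ vectorSpan ℝ G, ∃ p ∈ G, ∃ q ∈ G, ∃ t : ℝ, 0 ≤ t ∧ z = t • (p - q) := by
    intro z hz
    rw [vectorSpan_def] at hz
    induction hz using Submodule.span_induction with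
    | mem x hx =>
      obtain ⟨p, hp, q, hq, rfl⟩ := Set.mem_vsub.1 hx
      exact ⟨p, hp, q, hq, 1, zero_le_one, by simp⟩
    | zero =>
      obtain ⟨p, hp⟩ := hne
      exact ⟨p, hp, p, hp, 0, le_rfl, by simp⟩
    | add x y _ _ hx hy =>
      obtain ⟨p, hp, q, hq, s, hs, rfl⟩ := hx
      obtain ⟨p', hp', q', hq', t, ht, rfl⟩ := hy
      rcases (add_nonneg hs ht).eq_or_lt with h | h
      · have h1 : s = 0 := by linarith
        have h2 : t = 0 := by linarith
        exact ⟨p, hp, p, hp, 0, le_rfl, by simp [h1, h2]⟩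
      · have e : s / (s + t) + t / (s + t) = 1 := by field_simp
        refine ⟨(s / (s + t)) • p + (t / (s + t)) • p',
          hG hp hp' (by positivity) (by positivity) e,
          (s / (s + t)) • q + (t / (s + t)) • q',
          hG hq hq' (by positivity) (by positivity) e, s + t, h.le, ?_⟩
        have e1 : (s + t) * (s / (s + t)) = s := by field_simp
        have e2 : (s + t) * (t / (s + t)) = t := by field_simp
        simp only [smul_sub, smul_add, smul_smul, e1, e2]
        abel
    | smul c x _ hx =>
      obtain ⟨p, hp, q, hq, s, hs, rfl⟩ := hx
      rcases le_total 0 c with h | h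
      · exact ⟨p, hp, q, hq, c * s, mul_nonneg h hs, by rw [smul_smul]⟩
      · refine ⟨q, hq, p, hp, -(c * s), by nlinarith, ?_⟩
        rw [smul_smul, neg_smul, ← smul_neg, neg_sub]
  obtain ⟨p, hp, q, hq, t, -, h⟩ := key z hz
  exact ⟨p, hp, q, hq, t, h⟩

theorem injective_domRestrict_vectorSpan {π : E →ₗ[ℝ] F} {G : Set E} (hG : Convex ℝ G)
    (hne : G.Nonempty) (h : Set.InjOn π G) :
    Function.Injective (π.domRestrict (vectorSpan ℝ G)) := by
  rw [injective_iff_map_eq_zero]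
  rintro ⟨z, hz⟩ h0
  obtain ⟨p, hp, q, hq, t, rfl⟩ := exists_smul_sub_of_mem_vectorSpan hG hz hne
  simp only [LinearMap.domRestrict_apply, map_smul, map_sub, smul_eq_zero, sub_eq_zero] at h0
  ext
  rcases h0 with h0 | h0
  · simp [h0]
  · simp [h hp hq h0]

/-- On a convex set on which `π` is injective, every functional factors through `π` up to a
constant. -/
theorem exists_dual_factor {π : E →ₗ[ℝ] F} {G : Set E} (hG : Convex ℝ G)
    (hne : G.Nonempty) (h : Set.InjOn π G) (u : Module.Dual ℝ E) :
    ∃ ψ : Module.Dual ℝ F, faceOf G u = faceOf G (ψ ∘ₗ π) := by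
  obtain ⟨g, hg⟩ := LinearMap.exists_leftInverse_of_injective _
    (LinearMap.ker_eq_bot.2 (injective_domRestrict_vectorSpan hG hne h))
  refine ⟨u ∘ₗ (vectorSpan ℝ G).subtype ∘ₗ g, ?_⟩
  have key : ∀ x ∈ G, ∀ y ∈ G, u (x - y) = u ((g (π (x - y)) : vectorSpan ℝ G) : E) := by
    intro x hx y hy
    have hxy : x - y ∈ vectorSpan ℝ G := vsub_mem_vectorSpan ℝ hx hy
    have := LinearMap.congr_fun hg ⟨x - y, hxy⟩
    simp only [LinearMap.comp_apply, LinearMap.domRestrict_apply, LinearMap.id_apply] at this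
    rw [this]
  ext x
  refine and_congr_right fun hx => forall₂_congr fun y hy => ?_
  have := key x hx y hy
  simp only [map_sub, Submodule.coe_sub] at this
  simp only [LinearMap.comp_apply, Submodule.subtype_apply]
  constructor <;> intro h <;> linarith

end FiberMin

/-! ### Linear programming duality and existence of fine subdivisions. -/

section Existence

variable {E F : Type*} [NormedAddCommGroup E] [NormedSpace ℝ E] [FiniteDimensional ℝ E]
  [NormedAddCommGroup F] [InnerProductSpace ℝ F]

/-- Linear programming duality: over every point of `π(Q)` there is a point of `Q` minimizing
`w + ψ ∘ π` over the whole of `Q`, for a suitable multiplier `ψ`. -/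
theorem IsPolytope.exists_mem_faceOf_add_comp {π : E →ₗ[ℝ] F} {Q : Set E} (hQ : IsPolytope Q)
    (w : Module.Dual ℝ E) {y : F} (hy : y ∈ π '' Q) :
    ∃ ψ : Module.Dual ℝ F, ∃ x ∈ faceOf Q (w + ψ ∘ₗ π), π x = y := by
  have hπ : Continuous π := π.continuous_of_finiteDimensional
  have hw : Continuous w := w.continuous_of_finiteDimensional
  set 𝒢 : Set (Set E) := {G | ∃ ψ : Module.Dual ℝ F, G = faceOf Q (w + ψ ∘ₗ π)} with h𝒢
  have hfin : 𝒢.Finite := hQ.finite_faces.subset (by rintro _ ⟨ψ, rfl⟩; exact ⟨_, rfl⟩)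
  -- There are finitely many faces, so the points of `π(Q)` admitting a multiplier form a closed
  -- set; approximating `y` by such points is enough.
  have hcl : IsClosed (⋃ G ∈ 𝒢, π '' G) := by
    refine hfin.isClosed_biUnion ?_
    rintro _ ⟨ψ, rfl⟩
    exact ((isCompact_faceOf hQ.isCompact _).image hπ).isClosed
  suffices h : y ∈ ⋃ G ∈ 𝒢, π '' G by
    simp only [Set.mem_iUnion] at h
    obtain ⟨_, ⟨ψ, rfl⟩, x, hx, hxy⟩ := h
    exact ⟨ψ, x, hx, hxy⟩
  -- Quadratic penalty method: the constraint `π x = y` is relaxed and restored as `M → ∞`.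
  have hmin : ∀ M : ℝ, ∃ x ∈ Q, ∀ x' ∈ Q, w x + M * ‖π x - y‖ ^ 2 ≤ w x' + M * ‖π x' - y‖ ^ 2 :=
    fun M => hQ.isCompact.exists_isMinOn hQ.nonempty
      (f := fun x => w x + M * ‖π x - y‖ ^ 2) (by fun_prop)
  choose x hxQ hx using hmin
  obtain ⟨z, hz, hzy⟩ := hy
  have hmem : ∀ M : ℝ, π (x M) ∈ ⋃ G ∈ 𝒢, π '' G := by
    intro M
    -- The multiplier is the derivative of the penalty at its minimizer. First-order optimality
    -- along segments towards `q` then says that `x M` minimizes `w + ψ ∘ π` over `Q`.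
    set ψ : Module.Dual ℝ F := (2 * M) • (innerₗ F (π (x M) - y)) with hψ
    simp only [Set.mem_iUnion]
    refine ⟨_, ⟨ψ, rfl⟩, x M, ⟨hxQ M, fun q hq => ?_⟩, rfl⟩
    set c := M * ‖π (q - x M)‖ ^ 2
    set L := w (q - x M) + 2 * M * inner ℝ (π (x M) - y) (π (q - x M)) with hL
    have hquad : ∀ t : ℝ, 0 < t → t ≤ 1 → 0 ≤ L + t * c := by
      intro t h0 h1
      have hmem : x M + t • (q - x M) ∈ Q := by
        have := hQ.convex (hxQ M) hq (sub_nonneg.2 h1) h0.le (by ring)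
        convert this using 1
        module
      have h2 := hx M _ hmem
      have e : π (x M + t • (q - x M)) - y = (π (x M) - y) + t • π (q - x M) := by
        simp only [map_add, map_smul]; abel
      rw [e, norm_add_sq_real, inner_smul_right, norm_smul, mul_pow, Real.norm_eq_abs, sq_abs,
        map_add, map_smul, smul_eq_mul] at h2
      have h3 : 0 ≤ t * (L + t * c) := by
        simp only [hL, c]; nlinarith
      exact nonneg_of_mul_nonneg_right h3 h0
    have hL0 : 0 ≤ L := by
      have ht : Filter.Tendsto (fun t : ℝ => L + t * c) (nhdsWithin 0 (Set.Ioi 0))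
          (nhds (L + 0 * c)) := by
        refine Filter.Tendsto.mono_left (Continuous.tendsto (by fun_prop) 0) nhdsWithin_le_nhds
      have := ge_of_tendsto (b := 0) ht (by
        filter_upwards [Ioo_mem_nhdsGT (zero_lt_one' ℝ)] with t ht
        exact hquad t ht.1 ht.2.le)
      simpa using this
    simp only [hL, map_sub, inner_sub_right] at hL0
    simp only [hψ, LinearMap.add_apply, LinearMap.comp_apply, LinearMap.smul_apply, smul_eq_mul,
      innerₗ_apply_apply]
    nlinarith
  obtain ⟨p, hp, hpmin⟩ := hQ.isCompact.exists_isMinOn hQ.nonempty hw.continuousOn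
  have hlim : Filter.Tendsto (fun M : ℝ => π (x M)) Filter.atTop (nhds y) := by
    rw [tendsto_iff_norm_sub_tendsto_zero]
    have h2 : Filter.Tendsto (fun M : ℝ => ‖π (x M) - y‖ ^ 2) Filter.atTop (nhds 0) := by
      refine squeeze_zero' (g := fun M : ℝ => (w z - w p) / M)
        (Filter.Eventually.of_forall fun M => by positivity) ?_
        (tendsto_const_nhds.div_atTop Filter.tendsto_id)
      filter_upwards [Filter.eventually_gt_atTop 0] with M hM
      rw [le_div_iff₀ hM]
      have h1 := hx M z hz
      have h3 : w p ≤ w (x M) := hpmin (hxQ M)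
      simp only [hzy, sub_self, norm_zero] at h1
      nlinarith
    have h3 := h2.sqrt
    simpa using h3
  exact hcl.mem_of_tendsto hlim (Filter.Eventually.of_forall hmem)

/-- The coherent subdivision of `π(Q)` selected by `w` is fine if `w` separates the points with
equal projection in each face of `Q` on which `π` is not injective. -/
theorem IsPolytope.isFineSubdivision_coherent {π : E →ₗ[ℝ] F} {Q : Set E} (hQ : IsPolytope Q)
    {w : Module.Dual ℝ E}
    (hw : ∀ G, IsFace Q G → ¬ Set.InjOn π G → ∃ p ∈ G, ∃ q ∈ G, π p = π q ∧ w p ≠ w q) :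
    IsFineSubdivision π Q {G | ∃ ψ : Module.Dual ℝ F, G = faceOf Q (w + ψ ∘ₗ π)} := by
  have hinj : ∀ ψ : Module.Dual ℝ F, Set.InjOn π (faceOf Q (w + ψ ∘ₗ π)) := by
    intro ψ
    by_contra hcon
    obtain ⟨p, hp, q, hq, hpq, hne⟩ := hw _ ⟨_, rfl⟩ hcon
    have h1 := hp.2 q hq.1
    have h2 := hq.2 p hp.1
    simp only [LinearMap.add_apply, LinearMap.comp_apply, hpq, add_le_add_iff_right] at h1 h2
    exact hne (le_antisymm h1 h2)
  refine ⟨?_, ?_, ?_, ?_, ?_⟩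
  · rintro _ ⟨ψ, rfl⟩
    exact ⟨_, rfl⟩
  · rintro _ ⟨ψ, rfl⟩ _ ⟨u, rfl⟩
    obtain ⟨χ, hχ⟩ := exists_dual_factor (faceOf_convex hQ.convex _) (hQ.faceOf_nonempty _)
      (hinj ψ) u
    obtain ⟨ε, -, hε⟩ := hQ.exists_faceOf_faceOf (w + ψ ∘ₗ π) (χ ∘ₗ π)
    refine ⟨ψ + ε • χ, ?_⟩
    rw [hχ, ← hε]
    congr 1
    ext z
    simp [add_assoc]
  · rintro x ⟨_, ⟨ψ, rfl⟩, hx⟩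
    exact ⟨x, hx.1, rfl⟩
  · rintro x ⟨_, ⟨ψ, rfl⟩, hx⟩ x' ⟨_, ⟨ψ', rfl⟩, hx'⟩ hxx'
    exact hinj ψ' ((isFiberMin_of_mem_faceOf hx).mem_faceOf hx' hxx'.symm) hx' hxx'
  · intro y hy
    obtain ⟨ψ, x, hx, hxy⟩ := hQ.exists_mem_faceOf_add_comp w hy
    exact ⟨x, ⟨_, ⟨ψ, rfl⟩, hx⟩, hxy⟩

/-- Every functional is minimized, fiber by fiber, by the section of some fine subdivision. -/
theorem IsPolytope.exists_isFineSubdivision {π : E →ₗ[ℝ] F} {Q : Set E} (hQ : IsPolytope Q)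
    (w : Module.Dual ℝ E) :
    ∃ T, IsFineSubdivision π Q T ∧ ∀ x ∈ ⋃₀ T, IsFiberMin π Q w x := by
  classical
  have hfin := hQ.finite_faces
  have hpair : ∀ G : {G // IsFace Q G ∧ ¬ Set.InjOn π G},
      ∃ p ∈ G.1, ∃ q ∈ G.1, π p = π q ∧ p ≠ q := by
    rintro ⟨G, -, hG⟩
    simpa [Set.InjOn] using hG
  choose p hp q hq hpq hne using hpair
  have : Finite {G // IsFace Q G ∧ ¬ Set.InjOn π G} := (hfin.subset fun G hG => hG.1).to_subtype
  -- A generic perturbation: `η` separates one colliding pair in each face on which `π` is not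
  -- injective. For each pair at most one `ε` makes `w + ε • η` agree on it, so small positive `ε`
  -- give fine coherent subdivisions.
  obtain ⟨η, hη⟩ := Module.exists_dual_forall_apply_ne_zero (K := ℝ)
    (fun G => p G - q G) (fun G => sub_ne_zero.2 (hne G))
  have hgen : ∀ᶠ ε : ℝ in nhdsWithin 0 (Set.Ioi 0), ∀ G, (w + ε • η) (p G) ≠ (w + ε • η) (q G) := by
    rw [Filter.eventually_all]
    intro G
    have hsub : {ε : ℝ | (w + ε • η) (p G) = (w + ε • η) (q G)}.Subsingleton := by
      intro s hs t ht
      simp only [Set.mem_ofPred_eq, LinearMap.add_apply, LinearMap.smul_apply, smul_eq_mul] at hs ht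
      have h := hη G
      rw [map_sub] at h
      have : (s - t) * (η (p G) - η (q G)) = 0 := by linarith
      rcases mul_eq_zero.1 this with h' | h'
      · linarith
      · exact absurd h' h
    have hcl := (hsub.finite.subset (Set.sdiff_subset (t := {0}))).isClosed
    filter_upwards [self_mem_nhdsWithin, nhdsWithin_le_nhds
      (hcl.isOpen_compl.mem_nhds (show (0 : ℝ) ∈ _ from fun h => h.2 rfl))] with ε h0 h1 h2
    exact h1 ⟨h2, (ne_of_gt h0 : ε ≠ 0)⟩
  have hT : ∀ᶠ ε : ℝ in nhdsWithin 0 (Set.Ioi 0), ∃ T ∈ {T | T ⊆ {G | IsFace Q G}},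
      IsFineSubdivision π Q T ∧ ∀ x ∈ ⋃₀ T, IsFiberMin π Q (w + ε • η) x := by
    filter_upwards [hgen] with ε hε
    have hfine := hQ.isFineSubdivision_coherent (π := π) (w := w + ε • η)
      (fun G hG hGi => ⟨p ⟨G, hG, hGi⟩, hp ⟨G, hG, hGi⟩, q ⟨G, hG, hGi⟩,
        hq ⟨G, hG, hGi⟩, hpq _, hε _⟩)
    refine ⟨_, hfine.isFace, hfine, ?_⟩
    rintro x ⟨_, ⟨ψ, rfl⟩, hx⟩
    exact isFiberMin_of_mem_faceOf hx
  -- Finitely many candidates exist, so one `T` works for arbitrarily small `ε`; minimality for `w`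
  -- follows in the limit.
  obtain ⟨T, -, hTf⟩ : ∃ T ∈ {T | T ⊆ {G | IsFace Q G}},
      ∃ᶠ ε : ℝ in nhdsWithin 0 (Set.Ioi 0),
        IsFineSubdivision π Q T ∧ ∀ x ∈ ⋃₀ T, IsFiberMin π Q (w + ε • η) x := by
    by_contra hcon
    have := (hfin.finite_subsets.eventually_all (l := nhdsWithin (0 : ℝ) (Set.Ioi 0))
      (p := fun T ε => ¬ (IsFineSubdivision π Q T ∧
        ∀ x ∈ ⋃₀ T, IsFiberMin π Q (w + ε • η) x))).2
      (fun T hT => Filter.not_frequently.1 fun hf => hcon ⟨T, hT, hf⟩)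
    obtain ⟨ε, ⟨T, hTs, h1⟩, h2⟩ := (hT.and this).exists
    exact h2 T hTs h1
  refine ⟨T, hTf.exists.choose_spec.1, fun x hx => ?_⟩
  refine ⟨(hTf.exists.choose_spec.2 x hx).1, fun y hy hyx => ?_⟩
  by_contra! hlt
  have hc : Filter.Tendsto (fun ε : ℝ => (w + ε • η) x - (w + ε • η) y)
      (nhdsWithin 0 (Set.Ioi 0)) (nhds ((w + (0 : ℝ) • η) x - (w + (0 : ℝ) • η) y)) := by
    refine Filter.Tendsto.mono_left ?_ nhdsWithin_le_nhds
    simp only [LinearMap.add_apply, LinearMap.smul_apply, smul_eq_mul]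
    exact Continuous.tendsto (by fun_prop) 0
  have hev := hc.eventually (lt_mem_nhds (show (0 : ℝ) < _ by simpa using hlt))
  obtain ⟨ε, h1, h2⟩ := (hTf.and_eventually hev).exists
  have := (h1.2 x hx).2 y hy hyx
  linarith

end Existence

/-! ### Hausdorff measure on affine hulls of convex sets. -/

section Hausdorff

open scoped NNReal ENNReal

variable {W F : Type*}
  [NormedAddCommGroup W] [NormedSpace ℝ W] [FiniteDimensional ℝ W]
  [MeasurableSpace W] [BorelSpace W]
  [NormedAddCommGroup F] [NormedSpace ℝ F]

theorem affineDim_image {E : Type*} [AddCommGroup E] [Module ℝ E]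
    {π : E →ₗ[ℝ] F} {G : Set E} (hG : Convex ℝ G) (hne : G.Nonempty)
    (h : Set.InjOn π G) : affineDim (π '' G) = affineDim G := by
  have h1 : vectorSpan ℝ (π '' G) = LinearMap.range (π.domRestrict (vectorSpan ℝ G)) := by
    have := AffineMap.map_vectorSpan (f := π.toAffineMap) (s := G)
    simp only [LinearMap.toAffineMap_linear] at this
    rw [LinearMap.range_domRestrict, this]
    rfl
  rw [affineDim, affineDim, h1,
    LinearMap.finrank_range_of_inj (injective_domRestrict_vectorSpan hG hne h)]

theorem image_vectorSpan_preimage {G : Set F} {g : F} (hg : g ∈ G) :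
    (fun w : vectorSpan ℝ G => (vectorSpan ℝ G).subtype w + g) ''
      ((fun w : vectorSpan ℝ G => (vectorSpan ℝ G).subtype w + g) ⁻¹' G) = G := by
  refine Set.image_preimage_eq_of_subset fun x hx => ⟨⟨x - g, vsub_mem_vectorSpan ℝ hx hg⟩, ?_⟩
  simp

section

variable [MeasurableSpace F] [BorelSpace F]

theorem measurableEmbedding_affine {L : W →ₗ[ℝ] F} (hL : Function.Injective L) (x₀ : F) :
    MeasurableEmbedding fun w => L w + x₀ :=
  ((Homeomorph.addRight x₀).isClosedEmbedding.comp
    (LinearMap.isClosedEmbedding_of_injective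
      (LinearMap.ker_eq_bot.2 hL))).measurableEmbedding

end

variable [FiniteDimensional ℝ F]

theorem affineDim_mono {A B : Set F} (h : A ⊆ B) : affineDim A ≤ affineDim B :=
  Submodule.finrank_mono (vectorSpan_mono ℝ h)

theorem affineDim_faceOf_lt {G : Set F} {u : Module.Dual ℝ F} (hne : (faceOf G u).Nonempty)
    (h : faceOf G u ≠ G) : affineDim (faceOf G u) < affineDim G := by
  have hsub : faceOf G u ⊆ G := fun x hx => hx.1
  refine Submodule.finrank_lt_finrank_of_lt (lt_of_le_of_ne (vectorSpan_mono ℝ hsub) fun he => h ?_)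
  obtain ⟨x, hx⟩ := hne
  have h1 : vectorSpan ℝ (faceOf G u) ≤ LinearMap.ker u := by
    rw [vectorSpan_def, Submodule.span_le]
    rintro _ ⟨p, hp, q, hq, rfl⟩
    simp [le_antisymm (hp.2 q hq.1) (hq.2 p hp.1)]
  refine hsub.antisymm fun y hy => ⟨hy, fun z hz => ?_⟩
  have h2 : y - x ∈ vectorSpan ℝ G := vsub_mem_vectorSpan ℝ hy hx.1
  rw [← he] at h2
  have h3 := h1 h2
  rw [LinearMap.mem_ker, map_sub, sub_eq_zero] at h3
  rw [h3]
  exact hx.2 z hz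

variable [MeasurableSpace F] [BorelSpace F]

/-- Injective affine maps scale the Hausdorff measure by a positive constant. -/
theorem exists_restrict_range_eq_smul_map {L : W →ₗ[ℝ] F} (hL : Function.Injective L) (x₀ : F) :
    ∃ c : ℝ≥0, 0 < c ∧ (μH[(Module.finrank ℝ W : ℝ)] : Measure F).restrict
      (Set.range fun w => L w + x₀) = c • (μH[(Module.finrank ℝ W : ℝ)] : Measure W).map
        (fun w => L w + x₀) := by
  let e : W ≃L[ℝ] LinearMap.range L := (LinearEquiv.ofInjective L hL).toContinuousLinearEquiv
  have hr : Module.finrank ℝ (LinearMap.range L) = Module.finrank ℝ W :=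
    (LinearEquiv.ofInjective L hL).finrank_eq.symm
  have hiso : Isometry fun z : LinearMap.range L => (z : F) + x₀ :=
    (IsometryEquiv.addRight x₀).isometry.comp isometry_subtype_coe
  have hrange : Set.range (fun w => L w + x₀) =
      Set.range fun z : LinearMap.range L => (z : F) + x₀ := by
    ext y
    constructor
    · rintro ⟨w, rfl⟩; exact ⟨e w, rfl⟩
    · rintro ⟨⟨_, w, rfl⟩, rfl⟩; exact ⟨w, rfl⟩
  have hH : ((μH[(Module.finrank ℝ W : ℝ)] : Measure (LinearMap.range L))).IsAddHaarMeasure := by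
    rw [← hr]; infer_instance
  have hH' : ((μH[(Module.finrank ℝ W : ℝ)] : Measure W).map e).IsAddHaarMeasure :=
    e.isAddHaarMeasure_map _
  obtain ⟨c, hc0, hc⟩ : ∃ c : ℝ≥0, 0 < c ∧ (μH[(Module.finrank ℝ W : ℝ)] : Measure (LinearMap.range L)) =
      c • (μH[(Module.finrank ℝ W : ℝ)] : Measure W).map e :=
    ⟨_, Measure.addHaarScalarFactor_pos_of_isAddHaarMeasure _ _,
      Measure.isAddLeftInvariant_eq_smul _ _⟩
  refine ⟨c, hc0, ?_⟩
  rw [hrange, ← hiso.map_hausdorffMeasure (Or.inl (Nat.cast_nonneg _)), hc,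
    Measure.map_smul,
    Measure.map_map hiso.continuous.measurable e.continuous.measurable]
  rfl

theorem exists_scale {L : W →ₗ[ℝ] F} (hL : Function.Injective L) (x₀ : F) :
    ∃ c : ℝ≥0, 0 < c ∧ ∀ S : Set W, (μH[(Module.finrank ℝ W : ℝ)] : Measure F).restrict
      ((fun w => L w + x₀) '' S) = c • ((μH[(Module.finrank ℝ W : ℝ)] : Measure W).restrict S).map
        (fun w => L w + x₀) := by
  obtain ⟨c, hc0, hc⟩ := exists_restrict_range_eq_smul_map hL x₀
  have hemb := measurableEmbedding_affine hL x₀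
  refine ⟨c, hc0, fun S => ?_⟩
  rw [← Measure.restrict_restrict_of_subset (Set.image_subset_range _ S), hc,
    Measure.restrict_smul, hemb.restrict_map, Set.preimage_image_eq _ hemb.injective]

theorem hausdorffMeasure_eq_zero_of_affineDim_lt {S : Set F} (hS : Convex ℝ S) {r : ℕ}
    (h : affineDim S < r) : (μH[(r : ℝ)] : Measure F) S = 0 := by
  rcases S.eq_empty_or_nonempty with rfl | hne
  · simp
  · have h1 := Real.Convex.dimH_eq_finrank_vectorSpan hS hne
    have := hausdorffMeasure_of_dimH_lt (s := S) (d := (r : ℝ≥0)) (by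
      rw [h1]; exact_mod_cast h)
    simpa using this

instance isAddHaarMeasure_affineDim (K : Set F) :
    (μH[(affineDim K : ℝ)] : Measure (vectorSpan ℝ K)).IsAddHaarMeasure := by
  unfold affineDim; infer_instance

/-- In the direction space of `K` this measure is a Haar measure and `K` becomes a convex set with
dense interior, which every open set meeting `K` must meet. -/
theorem hausdorffMeasure_inter_pos {K U : Set F} (hK : Convex ℝ K) (hU : IsOpen U)
    (h : (U ∩ K).Nonempty) : (μH[(affineDim K : ℝ)] : Measure F) (U ∩ K) ≠ 0 := by
  obtain ⟨g, hgU, hg⟩ := h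
  set ι : vectorSpan ℝ K → F := fun w => (vectorSpan ℝ K).subtype w + g with hι
  have hiso : Isometry ι := (IsometryEquiv.addRight g).isometry.comp isometry_subtype_coe
  set S := ι ⁻¹' K with hS
  have hSK : ι '' S = K := image_vectorSpan_preimage hg
  have hconv : Convex ℝ S := by
    intro x hx y hy p q hp hq hpq
    have := hK hx hy hp hq hpq
    simp only [hS, hι, Set.mem_preimage] at this ⊢
    convert this using 1
    have : g = p • g + q • g := by rw [← add_smul, hpq, one_smul]
    simp only [map_add, map_smul, smul_add]
    nth_rewrite 1 [this]
    abel
  have hSne : S.Nonempty := ⟨0, by simpa [hS, hι] using hg⟩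
  have hspan : affineSpan ℝ S = ⊤ := by
    rw [AffineSubspace.affineSpan_eq_top_iff_vectorSpan_eq_top_of_nonempty _ _ _ hSne]
    let f : vectorSpan ℝ K →ᵃ[ℝ] F :=
      (vectorSpan ℝ K).subtype.toAffineMap + AffineMap.const ℝ (vectorSpan ℝ K) g
    have h1 := f.map_vectorSpan (s := S)
    have h2 : f '' S = K := hSK
    rw [h2] at h1
    simp only [f, AffineMap.add_linear, LinearMap.toAffineMap_linear, AffineMap.const_linear,
      add_zero] at h1
    apply Submodule.map_injective_of_injective (vectorSpan ℝ K).injective_subtype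
    simp [h1]
  have hint := (hconv.interior_nonempty_iff_affineSpan_eq_top).2 hspan
  have hcl := hconv.closure_interior_eq_closure_of_nonempty_interior hint
  have hUo : IsOpen (ι ⁻¹' U) := hU.preimage hiso.continuous
  have hmeet : (ι ⁻¹' U ∩ interior S).Nonempty := by
    have h0 : (0 : vectorSpan ℝ K) ∈ closure (interior S) := by
      rw [hcl]; exact subset_closure (by simpa [hS, hι] using hg)
    exact mem_closure_iff.1 h0 _ hUo (by simpa [hι] using hgU)
  have hpos : (μH[(affineDim K : ℝ)] : Measure (vectorSpan ℝ K)) (ι ⁻¹' U ∩ interior S) ≠ 0 :=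
    (hUo.inter isOpen_interior).measure_ne_zero _ hmeet
  rw [← hiso.hausdorffMeasure_image (Or.inl (Nat.cast_nonneg _))] at hpos
  refine fun h0 => hpos (measure_mono_null ?_ h0)
  rintro _ ⟨x, hx, rfl⟩
  exact ⟨hx.1, (interior_subset hx.2 : x ∈ S)⟩

theorem hausdorffMeasure_lt_top {K : Set F} (hK : IsCompact K) :
    (μH[(affineDim K : ℝ)] : Measure F) K < ⊤ := by
  rcases K.eq_empty_or_nonempty with rfl | ⟨g, hg⟩
  · simp
  set ι : vectorSpan ℝ K → F := fun w => (vectorSpan ℝ K).subtype w + g with hι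
  have hiso : Isometry ι := (IsometryEquiv.addRight g).isometry.comp isometry_subtype_coe
  have hSK : ι '' (ι ⁻¹' K) = K := image_vectorSpan_preimage hg
  have h := hiso.hausdorffMeasure_image (d := affineDim K) (Or.inl (Nat.cast_nonneg _)) (ι ⁻¹' K)
  rw [hSK] at h
  rw [h]
  exact (hiso.isClosedEmbedding.isCompact_preimage hK).measure_lt_top

end Hausdorff

/-! ### Centroids as integrals over projected cells. -/

section Centroid

variable {E F : Type*}
  [NormedAddCommGroup E] [NormedSpace ℝ E] [FiniteDimensional ℝ E]
  [MeasurableSpace E] [BorelSpace E]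
  [NormedAddCommGroup F] [NormedSpace ℝ F] [FiniteDimensional ℝ F]
  [MeasurableSpace F] [BorelSpace F]

/-- Both sides are pulled back to the direction space of `G`. The measures upstairs and downstairs
become multiples `a` and `b` of one measure; `a` cancels in the average and `b` appears on both
sides. -/
theorem vol_smul_centroid {π : E →ₗ[ℝ] F} {G : Set E} (hG : Convex ℝ G) (hGc : IsCompact G)
    (hne : G.Nonempty) (hinj : Set.InjOn π G) {s : F → E} (hs : ∀ x ∈ G, s (π x) = x) :
    vol (affineDim G) (π '' G) • centroid G =
      ∫ y in π '' G, s y ∂(μH[(affineDim G : ℝ)] : Measure F) := by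
  obtain ⟨g, hg⟩ := hne
  have hinj' := injective_domRestrict_vectorSpan hG ⟨g, hg⟩ hinj
  set W := vectorSpan ℝ G with hW
  set ι : W → E := fun w => W.subtype w + g with hι
  set κ : W → F := fun w => π.domRestrict W w + π g with hκ
  have hπι : ∀ w, π (ι w) = κ w := fun w => by simp [hι, hκ]
  set S := ι ⁻¹' G with hS
  have hSG : ι '' S = G := image_vectorSpan_preimage hg
  have hSF : κ '' S = π '' G := by
    rw [← hSG, Set.image_image]; simp only [hπι]
  have hScl : IsClosed S := hGc.isClosed.preimage (by fun_prop)
  have hiso : Isometry ι := (IsometryEquiv.addRight g).isometry.comp isometry_subtype_coe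
  have hSc : IsCompact S := hiso.isClosedEmbedding.isCompact_preimage hGc
  obtain ⟨a, ha0, ha⟩ := exists_scale (L := W.subtype) W.injective_subtype g
  obtain ⟨b, -, hb⟩ := exists_scale hinj' (π g)
  have hιe : MeasurableEmbedding ι := measurableEmbedding_affine W.injective_subtype g
  have hκe : MeasurableEmbedding κ := measurableEmbedding_affine hinj' (π g)
  have haS := ha S
  have hbS := hb S
  rw [show (fun w => W.subtype w + g) = ι from rfl, hSG] at haS
  rw [show (fun w => π.domRestrict W w + π g) = κ from rfl, hSF] at hbS
  have hvE : (μH[(Module.finrank ℝ W : ℝ)] : Measure E).real G =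
      a * (μH[(Module.finrank ℝ W : ℝ)] : Measure W).real S := by
    rw [← measureReal_restrict_apply_univ, haS, measureReal_nnreal_smul_apply,
      map_measureReal_apply hιe.measurable MeasurableSet.univ, Set.preimage_univ,
      measureReal_restrict_apply_univ]
  have hvF : (μH[(Module.finrank ℝ W : ℝ)] : Measure F).real (π '' G) =
      b * (μH[(Module.finrank ℝ W : ℝ)] : Measure W).real S := by
    rw [← measureReal_restrict_apply_univ, hbS, measureReal_nnreal_smul_apply,
      map_measureReal_apply hκe.measurable MeasurableSet.univ, Set.preimage_univ,
      measureReal_restrict_apply_univ]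
  have hs' : ∫ w in S, s (κ w) ∂(μH[(Module.finrank ℝ W : ℝ)]) =
      ∫ w in S, ι w ∂(μH[(Module.finrank ℝ W : ℝ)]) :=
    setIntegral_congr_fun hScl.measurableSet fun w hw => by rw [← hπι w, hs _ hw]
  change (μH[(Module.finrank ℝ W : ℝ)] : Measure F).real (π '' G) •
    (⨍ x in G, x ∂(μH[(Module.finrank ℝ W : ℝ)] : Measure E)) =
      ∫ y in π '' G, s y ∂(μH[(Module.finrank ℝ W : ℝ)] : Measure F)
  rw [setAverage_eq, hvE, hvF, haS, hbS, integral_smul_nnreal_measure,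
    integral_smul_nnreal_measure, hιe.integral_map, hκe.integral_map, hs']
  set m := (μH[(Module.finrank ℝ W : ℝ)] : Measure W).real S with hm
  rcases eq_or_ne m 0 with h0 | h0
  · have hS0 : (μH[(Module.finrank ℝ W : ℝ)] : Measure W) S = 0 := by
      exact (measureReal_eq_zero_iff hSc.measure_lt_top.ne).1 h0
    rw [Measure.restrict_eq_zero.2 hS0]
    simp
  · have ha1 : (a : ℝ) ≠ 0 := by exact_mod_cast ha0.ne'
    rw [NNReal.smul_def, NNReal.smul_def, smul_smul, smul_smul]
    congr 1
    field_simp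

end Centroid

set_option linter.unusedSectionVars false

/-! ### Sections of fine subdivisions and GKZ vectors. -/

section Sections

variable {E F : Type*}
  [NormedAddCommGroup E] [NormedSpace ℝ E] [NormedAddCommGroup F] [NormedSpace ℝ F]

/-- The section of `π : Q → π(Q)` given by a fine subdivision. -/
def sectionOf (π : E →ₗ[ℝ] F) (T : Set (Set E)) : F → E :=
  Function.invFunOn π (⋃₀ T)

namespace IsFineSubdivision

variable {π : E →ₗ[ℝ] F} {Q : Set E} {T : Set (Set E)}

theorem sectionOf_mem (hT : IsFineSubdivision π Q T) {y : F} (hy : y ∈ π '' Q) :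
    sectionOf π T y ∈ ⋃₀ T :=
  Function.invFunOn_mem (hT.bijOn.surjOn hy)

theorem map_sectionOf (hT : IsFineSubdivision π Q T) {y : F} (hy : y ∈ π '' Q) :
    π (sectionOf π T y) = y :=
  Function.invFunOn_eq (hT.bijOn.surjOn hy)

theorem sectionOf_map (hT : IsFineSubdivision π Q T) {x : E} (hx : x ∈ ⋃₀ T) :
    sectionOf π T (π x) = x :=
  hT.bijOn.injOn.leftInvOn_invFunOn hx

theorem sUnion_subset (hT : IsFineSubdivision π Q T) : ⋃₀ T ⊆ Q := by
  rintro x ⟨G, hG, hx⟩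
  obtain ⟨w, rfl⟩ := hT.isFace G hG
  exact hx.1

theorem finite (hT : IsFineSubdivision π Q T) [FiniteDimensional ℝ E] (hQ : IsPolytope Q) :
    T.Finite :=
  hQ.finite_faces.subset hT.isFace

theorem isCompact_of_mem (hT : IsFineSubdivision π Q T) [FiniteDimensional ℝ E]
    (hQ : IsPolytope Q) {G : Set E} (hG : G ∈ T) : IsCompact G := by
  obtain ⟨w, rfl⟩ := hT.isFace G hG
  exact isCompact_faceOf hQ.isCompact w

theorem convex_of_mem (hT : IsFineSubdivision π Q T)
    (hQ : IsPolytope Q) {G : Set E} (hG : G ∈ T) : Convex ℝ G := by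
  obtain ⟨w, rfl⟩ := hT.isFace G hG
  exact faceOf_convex hQ.convex w

theorem nonempty_of_mem (hT : IsFineSubdivision π Q T)
    (hQ : IsPolytope Q) {G : Set E} (hG : G ∈ T) : G.Nonempty := by
  obtain ⟨w, rfl⟩ := hT.isFace G hG
  exact hQ.faceOf_nonempty w

theorem injOn_of_mem (hT : IsFineSubdivision π Q T) {G : Set E} (hG : G ∈ T) : Set.InjOn π G :=
  hT.bijOn.injOn.mono (Set.subset_sUnion_of_mem hG)

/-- The section inverts a continuous injection on a compact set, the finite union of the cells. -/
theorem continuousOn_sectionOf [FiniteDimensional ℝ E]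
    (hT : IsFineSubdivision π Q T) (hQ : IsPolytope Q) :
    ContinuousOn (sectionOf π T) (π '' Q) := by
  have hc : IsCompact (⋃₀ T) := by
    rw [Set.sUnion_eq_biUnion]
    exact (hT.finite hQ).isCompact_biUnion fun G hG => hT.isCompact_of_mem hQ hG
  rw [continuousOn_iff_isClosed]
  intro t ht
  refine ⟨π '' (⋃₀ T ∩ t),
    ((hc.inter_right ht).image π.continuous_of_finiteDimensional).isClosed, ?_⟩
  ext y
  constructor
  · rintro ⟨h1, h2⟩
    exact ⟨⟨_, ⟨hT.sectionOf_mem h2, h1⟩, hT.map_sectionOf h2⟩, h2⟩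
  · rintro ⟨⟨x, ⟨hx1, hx2⟩, rfl⟩, h⟩
    exact ⟨by rwa [Set.mem_preimage, hT.sectionOf_map hx1], h⟩

variable [FiniteDimensional ℝ E] [FiniteDimensional ℝ F] [MeasurableSpace F] [BorelSpace F]

theorem image_inter_null (hT : IsFineSubdivision π Q T) (hQ : IsPolytope Q) {G H : Set E}
    (hG : G ∈ T) (hH : H ∈ T) (hne : G ∩ H ≠ G) :
    (μH[(affineDim (π '' Q) : ℝ)] : Measure F) (π '' (G ∩ H)) = 0 := by
  rcases (G ∩ H).eq_empty_or_nonempty with h | h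
  · simp [h]
  have hGH : Convex ℝ (G ∩ H) := (hT.convex_of_mem hQ hG).inter (hT.convex_of_mem hQ hH)
  refine hausdorffMeasure_eq_zero_of_affineDim_lt (hGH.linear_image π) ?_
  have hGQ : π '' G ⊆ π '' Q := Set.image_mono ((Set.subset_sUnion_of_mem hG).trans hT.sUnion_subset)
  refine lt_of_lt_of_le ?_ (affineDim_mono hGQ)
  rw [affineDim_image hGH h ((hT.injOn_of_mem hG).mono Set.inter_subset_left),
    affineDim_image (hT.convex_of_mem hQ hG) (hT.nonempty_of_mem hQ hG) (hT.injOn_of_mem hG)]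
  obtain ⟨f, rfl⟩ := hT.isFace G hG
  obtain ⟨g, rfl⟩ := hT.isFace H hH
  have he := faceOf_inter_faceOf h
  rw [he] at h hne ⊢
  exact affineDim_faceOf_lt h hne

/-- Injectivity on the union puts the overlap inside `π '' (G ∩ H)`. For distinct cells this
intersection is a proper face of at least one of them, or empty, so it has smaller dimension. -/
theorem aedisjoint (hT : IsFineSubdivision π Q T) (hQ : IsPolytope Q) {G H : Set E}
    (hG : G ∈ T) (hH : H ∈ T) (hne : G ≠ H) :
    AEDisjoint (μH[(affineDim (π '' Q) : ℝ)] : Measure F) (π '' G) (π '' H) := by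
  have hsub : π '' G ∩ π '' H ⊆ π '' (G ∩ H) := by
    rintro _ ⟨⟨x, hx, rfl⟩, ⟨x', hx', h⟩⟩
    have := hT.bijOn.injOn ⟨H, hH, hx'⟩ ⟨G, hG, hx⟩ h
    subst this
    exact ⟨_, ⟨hx, hx'⟩, rfl⟩
  refine measure_mono_null hsub ?_
  by_cases h : G ∩ H = G
  · rw [Set.inter_comm]
    refine hT.image_inter_null hQ hH hG fun h' => hne ?_
    rw [← h, Set.inter_comm, h']
  · exact hT.image_inter_null hQ hG hH h

variable [MeasurableSpace E] [BorelSpace E]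

theorem integrableOn_sectionOf (hT : IsFineSubdivision π Q T) (hQ : IsPolytope Q) :
    IntegrableOn (sectionOf π T) (π '' Q) (μH[(affineDim (π '' Q) : ℝ)] : Measure F) := by
  have hc : IsCompact (π '' Q) := hQ.isCompact.image π.continuous_of_finiteDimensional
  exact (hT.continuousOn_sectionOf hQ).integrableOn_of_subset_isCompact hc
    hc.measurableSet subset_rfl (hausdorffMeasure_lt_top hc).ne

/-- The GKZ vector of a fine subdivision is the average of the corresponding section. -/
theorem gkz_eq (hT : IsFineSubdivision π Q T) (hQ : IsPolytope Q) :
    gkz π Q T = (vol (affineDim (π '' Q)) (π '' Q))⁻¹ •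
      ∫ y in π '' Q, sectionOf π T y ∂(μH[(affineDim (π '' Q) : ℝ)] : Measure F) := by
  have hfin := (hT.finite hQ).to_subtype
  have hfint := Fintype.ofFinite T
  have hU : π '' Q = ⋃ G : T, π '' G.1 := by
    rw [← hT.bijOn.image_eq, Set.sUnion_eq_iUnion, Set.image_iUnion]
  have hπ : Continuous π := π.continuous_of_finiteDimensional
  have hint : ∫ y in π '' Q, sectionOf π T y ∂(μH[(affineDim (π '' Q) : ℝ)] : Measure F) =
      ∑ G : T, ∫ y in π '' G.1, sectionOf π T y ∂(μH[(affineDim (π '' Q) : ℝ)] : Measure F) := by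
    have := integral_iUnion_ae (μ := (μH[(affineDim (π '' Q) : ℝ)] : Measure F))
      (f := sectionOf π T) (s := fun G : T => π '' G.1)
      (fun G => ((hT.isCompact_of_mem hQ G.2).image hπ).isClosed.measurableSet.nullMeasurableSet)
      (fun G H hGH => hT.aedisjoint hQ G.2 H.2 (fun h => hGH (Subtype.ext h)))
      (by rw [← hU]; exact hT.integrableOn_sectionOf hQ)
    rwa [← hU, tsum_fintype] at this
  rw [hint, gkz, ← finsum_set_coe_eq_finsum_mem, finsum_eq_sum_of_fintype, Finset.smul_sum]
  refine Finset.sum_congr rfl fun G _ => ?_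
  have hGQ : π '' G.1 ⊆ π '' Q :=
    Set.image_mono ((Set.subset_sUnion_of_mem G.2).trans hT.sUnion_subset)
  have hdim := affineDim_image (hT.convex_of_mem hQ G.2) (hT.nonempty_of_mem hQ G.2)
    (hT.injOn_of_mem G.2)
  -- A cell of smaller dimension contributes zero to both the sum and the integral.
  rcases (affineDim_mono hGQ).lt_or_eq with hlt | heq
  · have h0 := hausdorffMeasure_eq_zero_of_affineDim_lt
      ((hT.convex_of_mem hQ G.2).linear_image π) hlt
    rw [Measure.restrict_eq_zero.2 h0]
    simp [vol, Measure.real, h0]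
  · have := vol_smul_centroid (hT.convex_of_mem hQ G.2) (hT.isCompact_of_mem hQ G.2)
      (hT.nonempty_of_mem hQ G.2) (hT.injOn_of_mem G.2)
      (s := sectionOf π T) (fun x hx => hT.sectionOf_map ⟨G, G.2, hx⟩)
    rw [← hdim, heq] at this
    rw [← this, smul_smul, div_eq_inv_mul]

end IsFineSubdivision

end Sections

/-! ### Faces of the fiber polytope and minimality on fibers. -/

section Comparison

variable {E F : Type*}
  [NormedAddCommGroup E] [NormedSpace ℝ E] [NormedAddCommGroup F] [InnerProductSpace ℝ F]
  [FiniteDimensional ℝ E] [FiniteDimensional ℝ F] [MeasurableSpace F] [BorelSpace F]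
  [MeasurableSpace E] [BorelSpace E]
  {π : E →ₗ[ℝ] F} {Q : Set E} {T T' : Set (Set E)}

theorem IsFineSubdivision.apply_gkz (hT : IsFineSubdivision π Q T) (hQ : IsPolytope Q)
    (w : Module.Dual ℝ E) :
    w (gkz π Q T) = (vol (affineDim (π '' Q)) (π '' Q))⁻¹ *
      ∫ y in π '' Q, w (sectionOf π T y) ∂(μH[(affineDim (π '' Q) : ℝ)] : Measure F) := by
  rw [hT.gkz_eq hQ, map_smul, smul_eq_mul]
  congr 1
  exact (ContinuousLinearMap.integral_comp_comm (LinearMap.toContinuousLinearMap w)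
    (hT.integrableOn_sectionOf hQ)).symm

theorem IsFineSubdivision.integrableOn_apply (hT : IsFineSubdivision π Q T) (hQ : IsPolytope Q)
    (w : Module.Dual ℝ E) : IntegrableOn (fun y => w (sectionOf π T y)) (π '' Q)
      (μH[(affineDim (π '' Q) : ℝ)] : Measure F) :=
  ContinuousLinearMap.integrable_comp (LinearMap.toContinuousLinearMap w)
    (hT.integrableOn_sectionOf hQ)

theorem IsPolytope.vol_pos (hQ : IsPolytope Q) (π : E →ₗ[ℝ] F) :
    0 < vol (affineDim (π '' Q)) (π '' Q) := by
  have h := hausdorffMeasure_inter_pos (hQ.convex.linear_image π) isOpen_univ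
    (by simpa using hQ.nonempty)
  rw [Set.univ_inter] at h
  exact ENNReal.toReal_pos h
    (hausdorffMeasure_lt_top (hQ.isCompact.image π.continuous_of_finiteDimensional)).ne

theorem IsFineSubdivision.apply_gkz_le (hT : IsFineSubdivision π Q T)
    (hT' : IsFineSubdivision π Q T') (hQ : IsPolytope Q) {w : Module.Dual ℝ E}
    (h : ∀ᵐ y ∂(μH[(affineDim (π '' Q) : ℝ)] : Measure F).restrict (π '' Q),
      w (sectionOf π T y) ≤ w (sectionOf π T' y)) :
    w (gkz π Q T) ≤ w (gkz π Q T') := by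
  rw [hT.apply_gkz hQ, hT'.apply_gkz hQ]
  exact mul_le_mul_of_nonneg_left
    (integral_mono_ae (hT.integrableOn_apply hQ w) (hT'.integrableOn_apply hQ w) h)
    (inv_nonneg.2 (hQ.vol_pos π).le)

/-- The difference of the two integrands is continuous, nonnegative and has integral at most zero.
If it were nonzero at a point, it would be nonzero on a relatively open set of positive measure. -/
theorem IsFineSubdivision.eq_of_apply_gkz_le (hT : IsFineSubdivision π Q T)
    (hT' : IsFineSubdivision π Q T') (hQ : IsPolytope Q) {w : Module.Dual ℝ E}
    (h : ∀ y ∈ π '' Q, w (sectionOf π T y) ≤ w (sectionOf π T' y))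
    (hle : w (gkz π Q T') ≤ w (gkz π Q T)) :
    ∀ y ∈ π '' Q, w (sectionOf π T' y) = w (sectionOf π T y) := by
  have hc : IsCompact (π '' Q) := hQ.isCompact.image π.continuous_of_finiteDimensional
  have hw : Continuous w := w.continuous_of_finiteDimensional
  have hcont : ContinuousOn (fun y => w (sectionOf π T' y) - w (sectionOf π T y)) (π '' Q) :=
    (hw.comp_continuousOn (hT'.continuousOn_sectionOf hQ)).sub
      (hw.comp_continuousOn (hT.continuousOn_sectionOf hQ))
  rw [hT.apply_gkz hQ, hT'.apply_gkz hQ] at hle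
  have hle' := le_of_mul_le_mul_left hle (inv_pos.2 (hQ.vol_pos π))
  have hint : ∫ y in π '' Q, (w (sectionOf π T' y) - w (sectionOf π T y))
      ∂(μH[(affineDim (π '' Q) : ℝ)] : Measure F) ≤ 0 := by
    rw [integral_sub (hT'.integrableOn_apply hQ w) (hT.integrableOn_apply hQ w)]
    linarith
  have hnn : 0 ≤ᵐ[(μH[(affineDim (π '' Q) : ℝ)] : Measure F).restrict (π '' Q)]
      fun y => w (sectionOf π T' y) - w (sectionOf π T y) := by
    filter_upwards [ae_restrict_mem hc.measurableSet] with y hy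
    exact sub_nonneg.2 (h y hy)
  have hae := (integral_eq_zero_iff_of_nonneg_ae hnn
    ((hT'.integrableOn_apply hQ w).sub (hT.integrableOn_apply hQ w))).1
      (le_antisymm hint (integral_nonneg_of_ae hnn))
  intro y hy
  by_contra hne
  have hne' : w (sectionOf π T' y) - w (sectionOf π T y) ≠ 0 := sub_ne_zero.2 hne
  obtain ⟨U, hU, hyU, hsub⟩ := mem_nhdsWithin.1 ((hcont y hy).eventually_ne hne')
  refine hausdorffMeasure_inter_pos (hQ.convex.linear_image π) hU ⟨y, hyU, hy⟩ ?_
  have h0 : ((μH[(affineDim (π '' Q) : ℝ)] : Measure F).restrict (π '' Q)) U = 0 := by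
    rw [Filter.EventuallyEq, ae_restrict_iff' hc.measurableSet] at hae
    rw [Measure.restrict_apply hU.measurableSet]
    refine measure_mono_null (fun z (hz : z ∈ U ∩ π '' Q) => ?_) (ae_iff.1 hae)
    exact fun hz' => hsub hz (hz' hz.2)
  rwa [Measure.restrict_apply hU.measurableSet] at h0

theorem IsPolytope.fiberPolytope (hQ : IsPolytope Q) (π : E →ₗ[ℝ] F) :
    IsPolytope (fiberPolytope π Q) := by
  refine ⟨_, ?_, ?_, rfl⟩
  · refine (hQ.finite_faces.finite_subsets.image (gkz π Q)).subset ?_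
    rintro _ ⟨T, hT, rfl⟩
    exact ⟨T, hT.isFace, rfl⟩
  · obtain ⟨T, hT, -⟩ := hQ.exists_isFineSubdivision (π := π) 0
    exact ⟨_, T, hT, rfl⟩

theorem IsFineSubdivision.gkz_mem (hT : IsFineSubdivision π Q T) :
    gkz π Q T ∈ HyperSec.fiberPolytope π Q :=
  subset_convexHull ℝ _ ⟨T, hT, rfl⟩

theorem IsFineSubdivision.le_of_isFiberMin (hT : IsFineSubdivision π Q T)
    (hT' : IsFineSubdivision π Q T') {w : Module.Dual ℝ E}
    (h : ∀ x ∈ ⋃₀ T, IsFiberMin π Q w x) {y : F} (hy : y ∈ π '' Q) :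
    w (sectionOf π T y) ≤ w (sectionOf π T' y) :=
  (h _ (hT.sectionOf_mem hy)).2 _ (hT'.sUnion_subset (hT'.sectionOf_mem hy))
    (by rw [hT.map_sectionOf hy, hT'.map_sectionOf hy])

theorem IsFineSubdivision.gkz_mem_faceOf (hT : IsFineSubdivision π Q T) (hQ : IsPolytope Q)
    {w : Module.Dual ℝ E}
    (h : ∀ᵐ y ∂(μH[(affineDim (π '' Q) : ℝ)] : Measure F).restrict (π '' Q),
      IsFiberMin π Q w (sectionOf π T y)) :
    gkz π Q T ∈ faceOf (HyperSec.fiberPolytope π Q) w := by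
  refine ⟨hT.gkz_mem, le_on_convexHull ?_⟩
  rintro _ ⟨T', hT', rfl⟩
  refine hT.apply_gkz_le hT' hQ ?_
  have hc : IsCompact (π '' Q) := hQ.isCompact.image π.continuous_of_finiteDimensional
  filter_upwards [h, ae_restrict_mem hc.measurableSet] with y hy hyQ
  exact hy.2 _ (hT'.sUnion_subset (hT'.sectionOf_mem hyQ))
    (by rw [hT.map_sectionOf hyQ, hT'.map_sectionOf hyQ])

/-- Comparison with a subdivision `S` that minimizes `w` on each fiber: equal averages force equal
values of `w` everywhere. -/
theorem IsFineSubdivision.isFiberMin_of_gkz_mem_faceOf (hT : IsFineSubdivision π Q T)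
    (hQ : IsPolytope Q) {w : Module.Dual ℝ E}
    (h : gkz π Q T ∈ faceOf (HyperSec.fiberPolytope π Q) w) :
    ∀ x ∈ ⋃₀ T, IsFiberMin π Q w x := by
  obtain ⟨S, hS, hSmin⟩ := hQ.exists_isFineSubdivision (π := π) w
  have heq := hS.eq_of_apply_gkz_le hT hQ (w := w) (fun y hy => hS.le_of_isFiberMin hT hSmin hy)
    (h.2 _ hS.gkz_mem)
  intro x hx
  have hxQ := hT.sUnion_subset hx
  refine ⟨hxQ, fun z hz hzx => ?_⟩
  have h1 := heq (π x) ⟨x, hxQ, rfl⟩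
  rw [hT.sectionOf_map hx] at h1
  rw [h1]
  exact (hSmin _ (hS.sectionOf_mem ⟨x, hxQ, rfl⟩)).2 z hz
    (by rw [hS.map_sectionOf ⟨x, hxQ, rfl⟩, hzx])

/-- An inclusion of faces of the fiber polytope can be checked fiber by fiber, on almost every
fiber. -/
theorem IsPolytope.faceOf_fiberPolytope_subset (hQ : IsPolytope Q) {w u : Module.Dual ℝ E}
    (h : ∀ᵐ y ∂(μH[(affineDim (π '' Q) : ℝ)] : Measure F).restrict (π '' Q),
      ∀ x, π x = y → IsFiberMin π Q w x → IsFiberMin π Q u x) :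
    faceOf (HyperSec.fiberPolytope π Q) w ⊆ faceOf (HyperSec.fiberPolytope π Q) u := by
  have hP := hQ.fiberPolytope π
  -- It suffices to test the extreme points of the face, and these are GKZ vectors.
  rw [← closure_convexHull_extremePoints (isCompact_faceOf hP.isCompact w)
    (faceOf_convex hP.convex w)]
  refine closure_minimal (convexHull_min ?_ (faceOf_convex hP.convex u))
    (isClosed_faceOf hP.isCompact.isClosed u)
  intro x hx
  have hx1 := (isExtreme_faceOf _ w).extremePoints_subset_extremePoints hx
  obtain ⟨T, hT, rfl⟩ := extremePoints_convexHull_subset hx1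
  have hmin := hT.isFiberMin_of_gkz_mem_faceOf hQ hx.1
  refine hT.gkz_mem_faceOf hQ ?_
  have hc : IsCompact (π '' Q) := hQ.isCompact.image π.continuous_of_finiteDimensional
  filter_upwards [h, ae_restrict_mem hc.measurableSet] with y hy hyQ
  exact hy _ (hT.map_sectionOf hyQ) (hmin _ (hT.sectionOf_mem hyQ))

/-- An inclusion of faces of the fiber polytope forces the corresponding implication between the
minimality conditions on every fiber. -/
theorem IsPolytope.isFiberMin_of_faceOf_fiberPolytope_subset (hQ : IsPolytope Q)
    {w u : Module.Dual ℝ E}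
    (h : faceOf (HyperSec.fiberPolytope π Q) w ⊆ faceOf (HyperSec.fiberPolytope π Q) u) {x : E}
    (hx : IsFiberMin π Q w x) : IsFiberMin π Q u x := by
  have hP := hQ.fiberPolytope π
  -- Perturbing `w` by `-u` selects a section `T` with the largest value of `u` among the minimizers
  -- of `w`. By hypothesis `T` also minimizes `u`, so every minimizer of `w` does.
  obtain ⟨ε, hε, hface⟩ := hP.exists_faceOf_faceOf w (-u)
  obtain ⟨T, hT, hTmin⟩ := hQ.exists_isFineSubdivision (π := π) (w + ε • -u)
  have hc : IsCompact (π '' Q) := hQ.isCompact.image π.continuous_of_finiteDimensional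
  have h1 : gkz π Q T ∈ faceOf (HyperSec.fiberPolytope π Q) (w + ε • -u) := by
    refine hT.gkz_mem_faceOf hQ ?_
    filter_upwards [ae_restrict_mem hc.measurableSet] with y hy
    exact hTmin _ (hT.sectionOf_mem hy)
  rw [hface] at h1
  have hTw := hT.isFiberMin_of_gkz_mem_faceOf hQ h1.1
  have hTu := hT.isFiberMin_of_gkz_mem_faceOf hQ (h h1.1)
  have hy : π x ∈ π '' Q := ⟨x, hx.1, rfl⟩
  have hs := hT.sectionOf_mem hy
  have hsπ := hT.map_sectionOf hy
  have a1 := hx.2 _ (hT.sUnion_subset hs) hsπ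
  have a2 := (hTmin _ hs).2 x hx.1 hsπ.symm
  simp only [LinearMap.add_apply, LinearMap.smul_apply, LinearMap.neg_apply, smul_eq_mul] at a2
  have a3 : u x ≤ u (sectionOf π T (π x)) := by
    have : ε * u x ≤ ε * u (sectionOf π T (π x)) := by linarith
    exact le_of_mul_le_mul_left this hε
  exact ⟨hx.1, fun z hz hzx => a3.trans ((hTu _ hs).2 z hz (hzx.trans hsπ.symm))⟩

end Comparison

/-! ### Inequality description of hypersimplices. -/

section Hypersimplex

variable {n : ℕ}

theorem dual_apply (w : Module.Dual ℝ (EuclideanSpace ℝ (Fin n))) (x : EuclideanSpace ℝ (Fin n)) :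
    w x = ∑ i, x i * w (EuclideanSpace.single i 1) := by
  have hx : x = ∑ i, x i • EuclideanSpace.single i (1 : ℝ) := by
    ext j
    simp [Finset.sum_apply, Pi.single_apply]
  conv_lhs => rw [hx]
  simp

/-- The description of the `k`-th hypersimplex on `J` by linear equations and inequalities. -/
def slice (J : Finset (Fin n)) (k : ℕ) : Set (EuclideanSpace ℝ (Fin n)) :=
  {x | (∀ i, 0 ≤ x i) ∧ (∀ i, x i ≤ 1) ∧ (∀ i ∉ J, x i = 0) ∧ ∑ i, x i = k}

/-- Feasible directions: only bounds that are already tight can obstruct a small move. -/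
theorem exists_pos_add_smul_mem_slice {J : Finset (Fin n)} {k : ℕ}
    {x c : EuclideanSpace ℝ (Fin n)} (hx : x ∈ slice J k) (hsum : ∑ i, c i = 0)
    (hJ : ∀ i ∉ J, c i = 0) (hneg : ∀ i, c i < 0 → 0 < x i) (hpos : ∀ i, 0 < c i → x i < 1) :
    ∃ t : ℝ, 0 < t ∧ x + t • c ∈ slice J k := by
  obtain ⟨h0, h1, h2, h3⟩ := hx
  have hlim : ∀ i, Filter.Tendsto (fun t : ℝ => x i + t * c i) (nhdsWithin 0 (Set.Ioi 0))
      (nhds (x i + 0 * c i)) := fun i =>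
    Filter.Tendsto.mono_left (Continuous.tendsto (by fun_prop) 0) nhdsWithin_le_nhds
  have hev : ∀ᶠ t : ℝ in nhdsWithin 0 (Set.Ioi 0), ∀ i, 0 ≤ x i + t * c i ∧ x i + t * c i ≤ 1 := by
    rw [Filter.eventually_all]
    intro i
    refine Filter.Eventually.and ?_ ?_
    · rcases lt_or_ge (c i) 0 with h | h
      · have := (hlim i).eventually (lt_mem_nhds (show (0 : ℝ) < _ by simpa using hneg i h))
        filter_upwards [this] with t ht using ht.le
      · filter_upwards [self_mem_nhdsWithin] with t ht
        exact add_nonneg (h0 i) (mul_nonneg (le_of_lt ht) h)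
    · rcases lt_or_ge 0 (c i) with h | h
      · have := (hlim i).eventually (gt_mem_nhds (show _ < (1 : ℝ) by simpa using hpos i h))
        filter_upwards [this] with t ht using ht.le
      · filter_upwards [self_mem_nhdsWithin] with t ht
        have := mul_nonpos_of_nonneg_of_nonpos (le_of_lt ht) h
        linarith [h1 i]
  obtain ⟨t, ht, ht0⟩ := (hev.and self_mem_nhdsWithin).exists
  refine ⟨t, ht0, fun i => ?_, fun i => ?_, fun i hi => ?_, ?_⟩
  · simpa using (ht i).1
  · simpa using (ht i).2
  · simp [h2 i hi, hJ i hi]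
  · simp [Finset.sum_add_distrib, h3, ← Finset.mul_sum, hsum]

theorem sum_single_apply (B : Finset (Fin n)) (j : Fin n) :
    (∑ i ∈ B, EuclideanSpace.single i (1 : ℝ)) j = if j ∈ B then 1 else 0 := by
  simp [Finset.sum_apply, Pi.single_apply]

theorem convex_slice (J : Finset (Fin n)) (k : ℕ) : Convex ℝ (slice J k) := by
  rintro x ⟨h0, h1, h2, h3⟩ y ⟨g0, g1, g2, g3⟩ p q hp hq hpq
  refine ⟨fun i => ?_, fun i => ?_, fun i hi => ?_, ?_⟩
  · have := add_nonneg (mul_nonneg hp (h0 i)) (mul_nonneg hq (g0 i))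
    simpa using this
  · have := add_le_add (mul_le_mul_of_nonneg_left (h1 i) hp) (mul_le_mul_of_nonneg_left (g1 i) hq)
    simpa [hpq] using this
  · simp [h2 i hi, g2 i hi]
  · simp [Finset.sum_add_distrib, ← Finset.mul_sum, h3, g3, ← add_mul, hpq]

theorem isCompact_slice (J : Finset (Fin n)) (k : ℕ) : IsCompact (slice J k) := by
  have hcl : IsClosed (slice J k) := by
    have : slice J k = (⋂ i, {x : EuclideanSpace ℝ (Fin n) | 0 ≤ x i}) ∩ ((⋂ i, {x | x i ≤ 1}) ∩
        ((⋂ i, ⋂ (_ : i ∉ J), {x | x i = 0}) ∩ {x | ∑ i, x i = k})) := by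
      ext x; simp [slice]
    rw [this]
    refine (isClosed_iInter fun i => isClosed_le (by fun_prop) (by fun_prop)).inter
      ((isClosed_iInter fun i => isClosed_le (by fun_prop) (by fun_prop)).inter
        ((isClosed_iInter fun i => isClosed_iInter fun _ => isClosed_eq (by fun_prop)
          (by fun_prop)).inter (isClosed_eq (by fun_prop) (by fun_prop))))
  refine Metric.isCompact_of_isClosed_isBounded hcl ?_
  refine (Metric.isBounded_closedBall (x := (0 : EuclideanSpace ℝ (Fin n))) (r := √n)).subset ?_
  rintro x ⟨h0, h1, -, -⟩
  rw [mem_closedBall_zero_iff, EuclideanSpace.norm_eq]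
  refine Real.sqrt_le_sqrt ?_
  calc ∑ i, ‖x i‖ ^ 2 ≤ ∑ i : Fin n, (1 : ℝ) := by
        refine Finset.sum_le_sum fun i _ => ?_
        rw [Real.norm_eq_abs, abs_of_nonneg (h0 i)]
        exact pow_le_one₀ (h0 i) (h1 i)
    _ = n := by simp

/-- The extreme points of `slice J k` have entries 0 or 1: two fractional entries could be traded
against each other in both directions. -/
theorem hypersimplex_eq_slice (J : Finset (Fin n)) (k : ℕ) : hypersimplex J k = slice J k := by
  set V := {x | ∃ B : Finset (Fin n), B ⊆ J ∧ B.card = k ∧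
    x = ∑ i ∈ B, EuclideanSpace.single i (1 : ℝ)} with hV
  have hVfin : V.Finite := by
    refine (Set.finite_range fun B : Finset (Fin n) =>
      ∑ i ∈ B, EuclideanSpace.single i (1 : ℝ)).subset ?_
    rintro _ ⟨B, -, -, rfl⟩
    exact ⟨B, rfl⟩
  refine Set.Subset.antisymm (convexHull_min ?_ (convex_slice J k)) ?_
  · rintro _ ⟨B, hB, hcard, rfl⟩
    refine ⟨fun i => ?_, fun i => ?_, fun i hi => ?_, ?_⟩
    · rw [sum_single_apply]; split_ifs <;> simp
    · rw [sum_single_apply]; split_ifs <;> simp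
    · rw [sum_single_apply, if_neg fun h => hi (hB h)]
    · simp only [sum_single_apply, Finset.sum_ite_mem, Finset.univ_inter, Finset.sum_const, hcard,
        nsmul_eq_mul, mul_one]
  · rw [← closure_convexHull_extremePoints (isCompact_slice J k) (convex_slice J k)]
    refine closure_minimal (convexHull_mono ?_) (hVfin.isCompact_convexHull ℝ).isClosed
    intro x hx
    obtain ⟨h0, h1, h2, h3⟩ := hx.1
    have hint : ∀ i, x i = 0 ∨ x i = 1 := by
      by_contra! hcon
      obtain ⟨i, hi0, hi1⟩ := hcon
      -- A single fractional entry would make the total `k` non-integral.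
      have hfrac : ∃ j ≠ i, x j ≠ 0 ∧ x j ≠ 1 := by
        by_contra! hall
        have hsum : ∑ j ∈ Finset.univ.erase i, x j =
            ((Finset.univ.erase i).filter fun j => x j = 1).card := by
          rw [Finset.card_filter]
          push_cast
          refine Finset.sum_congr rfl fun j hj => ?_
          split_ifs with h
          · exact h
          · by_contra h'
            exact h (hall j (Finset.ne_of_mem_erase hj) h')
        rw [← Finset.add_sum_erase _ _ (Finset.mem_univ i), hsum] at h3
        have e1 : (0 : ℝ) < x i := lt_of_le_of_ne (h0 i) (Ne.symm hi0)
        have e2 : x i < 1 := lt_of_le_of_ne (h1 i) hi1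
        set m := ((Finset.univ.erase i).filter fun j => x j = 1).card
        have e3 : m < k := by
          have : (m : ℝ) < k := by linarith
          exact_mod_cast this
        have e4 : k < m + 1 := by
          have : (k : ℝ) < m + 1 := by linarith
          exact_mod_cast this
        omega
      obtain ⟨j, hji, hj0, hj1⟩ := hfrac
      set c : EuclideanSpace ℝ (Fin n) :=
        EuclideanSpace.single i (1 : ℝ) - EuclideanSpace.single j (1 : ℝ) with hc
      have hci : c i = 1 := by simp [hc, hji.symm]
      have hcj : c j = -1 := by simp [hc, hji]
      have hco : ∀ l, l ≠ i → l ≠ j → c l = 0 := fun l hl hl' => by simp [hc, hl, hl']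
      have hsum : ∑ l, c l = 0 := by
        simp [hc, Finset.sum_sub_distrib]
      have hin : ∀ l, x l ≠ 0 → x l ≠ 1 → 0 < x l ∧ x l < 1 := fun l hl hl' =>
        ⟨lt_of_le_of_ne (h0 l) hl.symm, lt_of_le_of_ne (h1 l) hl'⟩
      have hne : ∀ l, c l ≠ 0 → 0 < x l ∧ x l < 1 := by
        intro l hl
        by_cases hli : l = i
        · subst hli; exact hin _ hi0 hi1
        by_cases hlj : l = j
        · subst hlj; exact hin _ hj0 hj1
        exact absurd (hco l hli hlj) hl
      have hcJ : ∀ l ∉ J, c l = 0 := by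
        intro l hl
        by_contra h
        exact (hne l h).1.ne' (h2 l hl)
      obtain ⟨t, ht, htm⟩ := exists_pos_add_smul_mem_slice hx.1 hsum hcJ
        (fun l hl => (hne l hl.ne).1) (fun l hl => (hne l hl.ne').2)
      obtain ⟨s, hs, hsm⟩ := exists_pos_add_smul_mem_slice (c := -c) hx.1 (by simp [hsum])
        (fun l hl => by simp [hcJ l hl])
        (fun l hl => (hne l (by simp at hl; exact hl.ne')).1)
        (fun l hl => (hne l (by simp at hl; exact hl.ne)).2)
      have hseg : x ∈ openSegment ℝ (x + t • c) (x + s • -c) := by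
        have e : s / (s + t) + t / (s + t) = 1 := by field_simp
        refine ⟨s / (s + t), t / (s + t), by positivity, by positivity, e, ?_⟩
        have e' : s / (s + t) * t - t / (s + t) * s = 0 := by field_simp; ring
        calc (s / (s + t)) • (x + t • c) + (t / (s + t)) • (x + s • -c)
            = (s / (s + t) + t / (s + t)) • x +
              (s / (s + t) * t - t / (s + t) * s) • c := by module
          _ = x := by rw [e, e']; simp
      have := hx.2 htm hsm hseg
      have h4 := congrArg (fun v : EuclideanSpace ℝ (Fin n) => v i) this
      simp [hci] at h4
      exact ht.ne' h4
    refine ⟨Finset.univ.filter fun i => x i = 1, ?_, ?_, ?_⟩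
    · intro i hi
      by_contra hiJ
      have := h2 i hiJ
      simp [this] at hi
    · have : ((Finset.univ.filter fun i => x i = 1).card : ℝ) = k := by
        rw [← h3, Finset.card_filter]
        push_cast
        refine Finset.sum_congr rfl fun i _ => ?_
        rcases hint i with h | h <;> simp [h]
      exact_mod_cast this
    · ext i
      rw [sum_single_apply]
      rcases hint i with h | h <;> simp [h]

theorem isPolytope_hypersimplex {J : Finset (Fin n)} {k : ℕ} (h : k ≤ J.card) :
    IsPolytope (hypersimplex J k) := by
  refine ⟨_, ?_, ?_, rfl⟩
  · refine (Set.finite_range fun B : Finset (Fin n) =>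
      ∑ i ∈ B, EuclideanSpace.single i (1 : ℝ)).subset ?_
    rintro _ ⟨B, -, -, rfl⟩
    exact ⟨B, rfl⟩
  · obtain ⟨B, hB, hc⟩ := Finset.exists_subset_card_eq h
    exact ⟨_, B, hB, hc, rfl⟩

end Hypersimplex

/-! ### Heights as reduced costs, circuits and sign compatibility. -/

section Lifted

variable {n d : ℕ}

/-- The homogenized configuration `(a_i, 1)`. -/
def lifted (a : Fin n → EuclideanSpace ℝ (Fin d)) (i : Fin n) : EuclideanSpace ℝ (Fin d) × ℝ :=
  (a i, 1)

/-- The height of the `i`-th lifted point above the hyperplane described by `p`, that is, the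
reduced cost of the variable `x_i`. -/
def height (a : Fin n → EuclideanSpace ℝ (Fin d)) (w : Module.Dual ℝ (EuclideanSpace ℝ (Fin n)))
    (p : Module.Dual ℝ (EuclideanSpace ℝ (Fin d) × ℝ)) (i : Fin n) : ℝ :=
  w (EuclideanSpace.single i 1) + p (lifted a i)

variable {a : Fin n → EuclideanSpace ℝ (Fin d)}
  {w u : Module.Dual ℝ (EuclideanSpace ℝ (Fin n))}
  {p q : Module.Dual ℝ (EuclideanSpace ℝ (Fin d) × ℝ)}

theorem sum_smul_lifted (x : EuclideanSpace ℝ (Fin n)) :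
    ∑ i, x i • lifted a i = (proj a x, ∑ i, x i) := by
  ext1
  · simp [lifted, proj, Prod.fst_sum]
  · simp [lifted, Prod.snd_sum]

/-- On a fiber of a hypersimplex the `p`-term is constant, so `w` may be replaced by the reduced
costs. -/
theorem sum_mul_height (x : EuclideanSpace ℝ (Fin n)) :
    ∑ i, x i * height a w p i = w x + p (proj a x, ∑ i, x i) := by
  rw [← sum_smul_lifted, dual_apply w x]
  simp [height, mul_add, Finset.sum_add_distrib]

/-- The signs of the heights with respect to `u` and `q` are compatible on `J` with the signs with
respect to `w` and `p`. -/
def SignCompatible (a : Fin n → EuclideanSpace ℝ (Fin d)) (J : Finset (Fin n))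
    (w u : Module.Dual ℝ (EuclideanSpace ℝ (Fin n)))
    (p q : Module.Dual ℝ (EuclideanSpace ℝ (Fin d) × ℝ)) : Prop :=
  ∀ j ∈ J, (height a w p j = 0 → height a u q j = 0) ∧
    (0 < height a w p j → 0 ≤ height a u q j) ∧ (height a w p j < 0 → height a u q j ≤ 0)

/-- The sufficiency half of complementary slackness: each term of the reduced cost is minimal
separately within the box. -/
theorem isFiberMin_of_height {J : Finset (Fin n)} {k : ℕ} {x : EuclideanSpace ℝ (Fin n)}
    (hx : x ∈ hypersimplex J k) (hpos : ∀ j ∈ J, 0 < height a w p j → x j = 0)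
    (hneg : ∀ j ∈ J, height a w p j < 0 → x j = 1) :
    IsFiberMin (proj a) (hypersimplex J k) w x := by
  refine ⟨hx, fun y hy hyx => ?_⟩
  rw [hypersimplex_eq_slice] at hx hy
  have hx' := sum_mul_height (a := a) (w := w) (p := p) x
  have hy' := sum_mul_height (a := a) (w := w) (p := p) y
  rw [hyx, hy.2.2.2] at hy'
  rw [hx.2.2.2] at hx'
  have : ∑ i, x i * height a w p i ≤ ∑ i, y i * height a w p i := by
    refine Finset.sum_le_sum fun i _ => ?_
    by_cases hi : i ∈ J
    · rcases lt_trichotomy (height a w p i) 0 with h | h | h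
      · rw [hneg i hi h]
        nlinarith [hy.2.1 i]
      · simp [h]
      · rw [hpos i hi h, zero_mul]
        exact mul_nonneg (hy.1 i) h.le
    · rw [hx.2.2.1 i hi, hy.2.2.1 i hi]
  linarith

theorem IsFiberMin.nonneg_of_feasible {J : Finset (Fin n)} {k : ℕ}
    {x c : EuclideanSpace ℝ (Fin n)} (hx : IsFiberMin (proj a) (hypersimplex J k) u x)
    (hπ : proj a c = 0) (hsum : ∑ i, c i = 0)
    (hJ : ∀ i ∉ J, c i = 0) (hneg : ∀ i, c i < 0 → 0 < x i) (hpos : ∀ i, 0 < c i → x i < 1) :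
    0 ≤ u c := by
  have hxs := hx.1
  rw [hypersimplex_eq_slice] at hxs
  obtain ⟨t, ht, hm⟩ := exists_pos_add_smul_mem_slice hxs hsum hJ hneg hpos
  rw [← hypersimplex_eq_slice] at hm
  have := hx.2 _ hm (by simp [hπ])
  simp only [map_add, map_smul, smul_eq_mul, le_add_iff_nonneg_right] at this
  exact nonneg_of_mul_nonneg_right this ht

/-- A basis among the lifted points with labels in `S`, together with its dual basis. -/
theorem exists_dual_basis {S : Set (Fin n)} (hS : Submodule.span ℝ (lifted a '' S) = ⊤) :
    ∃ (B : Finset (Fin n)) (β : Fin n → Module.Dual ℝ (EuclideanSpace ℝ (Fin d) × ℝ)),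
      ↑B ⊆ S ∧ B.card = d + 1 ∧
      (∀ i ∈ B, ∀ j ∈ B, β i (lifted a j) = if i = j then 1 else 0) ∧
      ∀ v, v = ∑ i ∈ B, β i v • lifted a i := by
  classical
  obtain ⟨κ, f, hf, hspan, hli⟩ := exists_linearIndependent' ℝ (fun i : S => lifted a i)
  have hfin : Finite κ := Finite.of_injective f hf
  have := Fintype.ofFinite κ
  have hr : Set.range (fun i : S => lifted a i) = lifted a '' S := by
    ext v; simp
  rw [hr, hS] at hspan
  let b := Module.Basis.mk hli hspan.ge
  have hb : ∀ i, b i = lifted a (f i) := fun i => by simp [b]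
  have hinj : Function.Injective fun i => (f i : Fin n) := Subtype.val_injective.comp hf
  have hcard : Fintype.card κ = d + 1 := by
    rw [← Module.finrank_eq_card_basis b]; simp
  let g : Fin n → Module.Dual ℝ (EuclideanSpace ℝ (Fin d) × ℝ) := fun j =>
    if h : ∃ i, (f i : Fin n) = j then b.coord h.choose else 0
  have hg : ∀ i, g (f i) = b.coord i := by
    intro i
    have h : ∃ i', (f i' : Fin n) = f i := ⟨i, rfl⟩
    simp only [g, dif_pos h]
    congr 1
    exact hinj h.choose_spec
  refine ⟨Finset.univ.map ⟨_, hinj⟩, g, ?_, by simpa using hcard, ?_, ?_⟩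
  · intro j hj
    simp only [Finset.coe_map, Function.Embedding.coeFn_mk, Finset.coe_univ, Set.image_univ,
      Set.mem_range] at hj
    obtain ⟨i, rfl⟩ := hj
    exact (f i).2
  · simp only [Finset.mem_map, Finset.mem_univ, true_and, Function.Embedding.coeFn_mk,
      forall_exists_index, forall_apply_eq_imp_iff]
    intro i j
    rw [hg, ← hb, Module.Basis.coord_apply, b.repr_self, Finsupp.single_apply]
    simp only [hinj.eq_iff, eq_comm]
  · intro v
    rw [Finset.sum_map]
    simp only [Function.Embedding.coeFn_mk, hg, ← hb, Module.Basis.coord_apply]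
    exact (b.sum_repr v).symm

theorem span_lifted_eq_top_of_dual_basis {B : Finset (Fin n)}
    {β : Fin n → Module.Dual ℝ (EuclideanSpace ℝ (Fin d) × ℝ)}
    (h : ∀ v, v = ∑ i ∈ B, β i v • lifted a i) {S : Set (Fin n)} (hBS : ↑B ⊆ S) :
    Submodule.span ℝ (lifted a '' S) = ⊤ := by
  rw [eq_top_iff]
  intro v _
  rw [h v]
  exact Submodule.sum_mem _ fun i hi =>
    Submodule.smul_mem _ _ (Submodule.subset_span ⟨i, hBS hi, rfl⟩)

theorem eq_of_height_eq_on_spanning {S : Set (Fin n)}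
    (hS : Submodule.span ℝ (lifted a '' S) = ⊤)
    (h : ∀ i ∈ S, height a u p i = height a u q i) : p = q := by
  refine LinearMap.ext_on hS ?_
  rintro _ ⟨i, hi, rfl⟩
  have := h i hi
  simpa [height] using this

/-- The circuit `e_j - ∑_B λ_b e_b` expressing the `j`-th lifted point in a basis. -/
def circuit (a : Fin n → EuclideanSpace ℝ (Fin d)) (B : Finset (Fin n))
    (β : Fin n → Module.Dual ℝ (EuclideanSpace ℝ (Fin d) × ℝ)) (j : Fin n) :
    EuclideanSpace ℝ (Fin n) :=
  EuclideanSpace.single j 1 - ∑ i ∈ B, β i (lifted a j) • EuclideanSpace.single i (1 : ℝ)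

section Circuit

variable {B : Finset (Fin n)} {β : Fin n → Module.Dual ℝ (EuclideanSpace ℝ (Fin d) × ℝ)}

theorem circuit_apply (j l : Fin n) : circuit a B β j l =
    (if l = j then 1 else 0) - if l ∈ B then β l (lifted a j) else 0 := by
  simp [circuit, Finset.sum_apply, Pi.single_apply]

theorem sum_smul_circuit (hβ : ∀ v, v = ∑ i ∈ B, β i v • lifted a i) (j : Fin n) :
    ∑ l, circuit a B β j l • lifted a l = 0 := by
  simp only [circuit_apply, sub_smul, Finset.sum_sub_distrib, ite_smul, one_smul, zero_smul,
    Finset.sum_ite_mem, Finset.univ_inter, Finset.sum_ite_eq', Finset.mem_univ, if_true]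
  rw [← hβ, sub_self]

theorem proj_circuit (hβ : ∀ v, v = ∑ i ∈ B, β i v • lifted a i) (j : Fin n) :
    proj a (circuit a B β j) = 0 ∧ ∑ l, circuit a B β j l = 0 := by
  have := sum_smul_circuit hβ j
  rw [sum_smul_lifted] at this
  exact ⟨congrArg Prod.fst this, congrArg Prod.snd this⟩

/-- The circuit is a linear relation among the lifted points, so `q` does not change its cost; the
basis entries then have height zero and only the entry `j` remains. -/
theorem apply_circuit (hβ : ∀ v, v = ∑ i ∈ B, β i v • lifted a i)
    (hq : ∀ i ∈ B, height a u q i = 0) (j : Fin n) : u (circuit a B β j) = height a u q j := by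
  have h := sum_mul_height (a := a) (w := u) (p := q) (circuit a B β j)
  rw [(proj_circuit hβ j).1, (proj_circuit hβ j).2, Prod.mk_zero_zero, map_zero, add_zero] at h
  rw [← h]
  simp only [circuit_apply, sub_mul, Finset.sum_sub_distrib, ite_mul, one_mul, zero_mul,
    Finset.sum_ite_mem, Finset.univ_inter, Finset.sum_ite_eq', Finset.mem_univ, if_true]
  rw [Finset.sum_eq_zero fun i hi => by rw [hq i hi, mul_zero], sub_zero]

theorem exists_height_eq_zero (hββ : ∀ i ∈ B, ∀ j ∈ B, β i (lifted a j) = if i = j then 1 else 0)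
    (u : Module.Dual ℝ (EuclideanSpace ℝ (Fin n))) :
    ∃ q, ∀ i ∈ B, height a u q i = 0 := by
  refine ⟨-∑ i ∈ B, u (EuclideanSpace.single i 1) • β i, fun j hj => ?_⟩
  have : ∑ i ∈ B, u (EuclideanSpace.single i 1) * β i (lifted a j) =
      u (EuclideanSpace.single j 1) := by
    rw [Finset.sum_eq_single j]
    · simp [hββ j hj j hj]
    · intro i hi hij
      simp [hββ i hi j hj, hij]
    · exact fun h => absurd hj h
  simp [height, this]

end Circuit

/-- Compatibility at a vertex of the hyperplane arrangement is forced by minimality on the fibers,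
if the corresponding cell is a genuine hypersimplex. -/
theorem exists_signCompatible {J : Finset (Fin n)} {k : ℕ}
    (hK : ∀ x, IsFiberMin (proj a) (hypersimplex J k) w x →
      IsFiberMin (proj a) (hypersimplex J k) u x)
    (hspan : Submodule.span ℝ (lifted a '' {j | j ∈ J ∧ height a w p j = 0}) = ⊤)
    (hl : (J.filter fun j => height a w p j < 0).card < k)
    (hm : k < (J.filter fun j => height a w p j ≤ 0).card) :
    ∃ q, SignCompatible a J w u p q := by
  classical
  obtain ⟨B, β, hBS, -, hββ, hβ⟩ := exists_dual_basis hspan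
  obtain ⟨q, hq⟩ := exists_height_eq_zero hββ u
  set l := (J.filter fun j => height a w p j < 0).card with hl'
  set m := (J.filter fun j => height a w p j = 0).card with hm'
  have hlm : (J.filter fun j => height a w p j ≤ 0).card = l + m := by
    rw [hl', hm', ← Finset.card_union_of_disjoint, ← Finset.filter_or]
    · simp only [le_iff_lt_or_eq]
    · refine Finset.disjoint_filter.2 fun j _ h1 h2 => ?_
      exact h1.ne h2
  rw [hlm] at hm
  have hlk : (l : ℝ) < k := by exact_mod_cast hl
  have hkm : (k : ℝ) < l + m := by exact_mod_cast hm
  have hm0 : (0 : ℝ) < m := by linarith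
  -- Spreading the remaining mass `k - l` evenly over the zero heights. Both strict bounds on the
  -- counts give `0 < θ < 1`, so basis coordinates can move either way along a circuit.
  set θ : ℝ := (k - l) / m with hθ
  have hθ0 : 0 < θ := div_pos (by linarith) hm0
  have hθ1 : θ < 1 := by rw [hθ, div_lt_one hm0]; linarith
  set x : EuclideanSpace ℝ (Fin n) := WithLp.toLp 2 fun j =>
    if j ∈ J then (if height a w p j < 0 then 1 else if height a w p j = 0 then θ else 0) else 0
    with hx
  have hxJ : ∀ j, x j = if j ∈ J then (if height a w p j < 0 then 1 else
    if height a w p j = 0 then θ else 0) else 0 := fun j => rfl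
  have hxm : x ∈ hypersimplex J k := by
    rw [hypersimplex_eq_slice]
    refine ⟨fun i => ?_, fun i => ?_, fun i hi => ?_, ?_⟩
    · rw [hxJ]; split_ifs <;> linarith
    · rw [hxJ]; split_ifs <;> linarith
    · rw [hxJ, if_neg hi]
    · have : ∀ j ∈ J, x j = (if height a w p j < 0 then 1 else 0) +
          (if height a w p j = 0 then θ else 0) := by
        intro j hj
        rw [hxJ, if_pos hj]
        by_cases h : height a w p j < 0
        · simp [h, h.ne]
        · simp [h]
      rw [← Finset.sum_subset (Finset.subset_univ J) (fun j _ hj => by rw [hxJ, if_neg hj]),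
        Finset.sum_congr rfl this, Finset.sum_add_distrib, Finset.sum_ite, Finset.sum_ite]
      simp only [Finset.sum_const, nsmul_eq_mul, mul_one, mul_zero, add_zero]
      rw [← hl', ← hm', hθ]
      field_simp
      ring
  have hmin := hK x (isFiberMin_of_height hxm
    (fun j hj h => by rw [hxJ, if_pos hj, if_neg h.le.not_gt, if_neg h.ne'])
    (fun j hj h => by rw [hxJ, if_pos hj, if_pos h]))
  have hxB : ∀ i ∈ B, x i = θ := fun i hi => by
    have := hBS hi
    rw [hxJ, if_pos this.1, if_neg this.2.not_lt, if_pos this.2]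
  have hcJ : ∀ j ∈ J, ∀ i ∉ J, circuit a B β j i = 0 := by
    intro j hj i hi
    have h1 : i ≠ j := fun h => hi (h ▸ hj)
    have h2 : i ∉ B := fun h => hi (hBS h).1
    rw [circuit_apply, if_neg h1, if_neg h2, sub_zero]
  have hco : ∀ j, ∀ i, i ≠ j → circuit a B β j i ≠ 0 → x i = θ := by
    intro j i hij hne
    refine hxB i ?_
    by_contra h
    exact hne (by rw [circuit_apply, if_neg hij, if_neg h, sub_zero])
  have hcj : ∀ j ∉ B, circuit a B β j j = 1 := by
    intro j hj
    rw [circuit_apply, if_pos rfl, if_neg hj, sub_zero]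
  -- Increasing `x j` along its circuit is feasible, and the cost of doing so is the height of `j`
  -- with respect to `u`; `key2` uses the opposite direction.
  have key1 : ∀ j ∈ J, j ∉ B → x j < 1 → 0 ≤ height a u q j := by
    intro j hj hjB hlt
    rw [← apply_circuit hβ hq]
    refine hmin.nonneg_of_feasible (proj_circuit hβ j).1 (proj_circuit hβ j).2 (hcJ j hj) ?_ ?_
    · intro i hi
      have hij : i ≠ j := by
        rintro rfl
        rw [hcj _ hjB] at hi
        linarith
      rw [hco j i hij hi.ne]; exact hθ0
    · intro i hi
      by_cases hij : i = j
      · rwa [hij]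
      · rw [hco j i hij hi.ne']; exact hθ1
  have key2 : ∀ j ∈ J, j ∉ B → 0 < x j → height a u q j ≤ 0 := by
    intro j hj hjB hlt
    rw [← apply_circuit hβ hq, ← neg_nonneg, ← map_neg]
    refine hmin.nonneg_of_feasible (by rw [map_neg, (proj_circuit hβ j).1, neg_zero])
      (by simp [(proj_circuit hβ j).2]) (fun i hi => by simp [hcJ j hj i hi]) ?_ ?_
    · intro i hi
      by_cases hij : i = j
      · rwa [hij]
      · rw [hco j i hij (by simp at hi; exact hi.ne')]; exact hθ0
    · intro i hi
      have hij : i ≠ j := by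
        rintro rfl
        simp [hcj _ hjB] at hi
        linarith
      rw [hco j i hij (by simp at hi; exact hi.ne)]; exact hθ1
  refine ⟨q, fun j hj => ?_⟩
  by_cases hjB : j ∈ B
  · have h := hq j hjB
    exact ⟨fun _ => h, fun _ => h.ge, fun _ => h.le⟩
  refine ⟨fun h => ?_, fun h => ?_, fun h => ?_⟩
  · have hxj : x j = θ := by rw [hxJ, if_pos hj, if_neg h.not_lt, if_pos h]
    exact le_antisymm (key2 j hj hjB (hxj ▸ hθ0)) (key1 j hj hjB (hxj ▸ hθ1))
  · refine key1 j hj hjB ?_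
    rw [hxJ, if_pos hj, if_neg h.le.not_gt, if_neg h.ne']; exact one_pos
  · refine key2 j hj hjB ?_
    rw [hxJ, if_pos hj, if_pos h]; exact one_pos

end Lifted

/-! ### Generic fibers and vertices of the hyperplane arrangement. -/

section Generic

variable {n d : ℕ} {a : Fin n → EuclideanSpace ℝ (Fin d)}
  {w u : Module.Dual ℝ (EuclideanSpace ℝ (Fin n))}
  {p q : Module.Dual ℝ (EuclideanSpace ℝ (Fin d) × ℝ)} {J : Finset (Fin n)} {k : ℕ}

theorem slice_card_subsingleton (J : Finset (Fin n)) : (slice J J.card).Subsingleton := by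
  have key : ∀ x ∈ slice J J.card, ∀ j ∈ J, x j = 1 := by
    intro x hx j hj
    refine le_antisymm (hx.2.1 j) ?_
    by_contra! hlt
    have h1 : ∑ i, x i = ∑ i ∈ J, x i :=
      (Finset.sum_subset (Finset.subset_univ J) fun i _ hi => hx.2.2.1 i hi).symm
    have h2 : ∑ i ∈ J, x i < ∑ i ∈ J, (1 : ℝ) :=
      Finset.sum_lt_sum (fun i _ => hx.2.1 i) ⟨j, hj, hlt⟩
    have h3 := hx.2.2.2
    rw [h1] at h3
    simp [h3] at h2
  intro x hx y hy
  ext j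
  by_cases hj : j ∈ J
  · rw [key x hx j hj, key y hy j hj]
  · rw [hx.2.2.1 j hj, hy.2.2.1 j hj]

/-- A linear functional is minimized over a hypersimplex by choosing the coordinates below some
threshold. -/
theorem exists_threshold (hk : 1 ≤ k) {g : Module.Dual ℝ (EuclideanSpace ℝ (Fin n))}
    {x : EuclideanSpace ℝ (Fin n)} (hx : x ∈ faceOf (hypersimplex J k) g) :
    ∃ c : ℝ, (∃ j ∈ J, g (EuclideanSpace.single j 1) = c) ∧
      (∀ j ∈ J, g (EuclideanSpace.single j 1) < c → x j = 1) ∧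
      (∀ j ∈ J, c < g (EuclideanSpace.single j 1) → x j = 0) := by
  have hxs : x ∈ slice J k := by rw [← hypersimplex_eq_slice]; exact hx.1
  have hex : ∀ i ∈ J, ∀ j ∈ J, x i < 1 → 0 < x j →
      g (EuclideanSpace.single j 1) ≤ g (EuclideanSpace.single i 1) := by
    intro i hi j hj hxi hxj
    -- Exchange argument: moving mass from `j` to `i` is feasible and cannot lower `g`. The
    -- threshold is then the largest value of `g` on a coordinate in use.
    rcases eq_or_ne i j with rfl | hij
    · exact le_rfl
    obtain ⟨t, ht, hm⟩ := exists_pos_add_smul_mem_slice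
      (c := EuclideanSpace.single i (1 : ℝ) - EuclideanSpace.single j (1 : ℝ)) hxs
      (by simp [Finset.sum_sub_distrib])
      (fun l hl => by
        have h1 : l ≠ i := fun h => hl (h ▸ hi)
        have h2 : l ≠ j := fun h => hl (h ▸ hj)
        simp [h1, h2])
      (fun l hl => by
        by_cases h2 : l = j
        · rwa [h2]
        · by_cases h1 : l = i
          · subst h1; simp [h2] at hl; linarith
          · simp [h1, h2] at hl)
      (fun l hl => by
        by_cases h1 : l = i
        · rwa [h1]
        · by_cases h2 : l = j
          · subst h2; simp [h1] at hl; linarith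
          · simp [h1, h2] at hl)
    rw [← hypersimplex_eq_slice] at hm
    have := hx.2 _ hm
    simp only [map_add, map_smul, map_sub, smul_eq_mul, le_add_iff_nonneg_right] at this
    have := nonneg_of_mul_nonneg_right this ht
    linarith
  have hne : (J.filter fun j => 0 < x j).Nonempty := by
    by_contra hemp
    rw [Finset.not_nonempty_iff_eq_empty, Finset.filter_eq_empty_iff] at hemp
    have h0 : ∑ i, x i = 0 := Finset.sum_eq_zero fun i _ => by
      by_cases hi : i ∈ J
      · exact le_antisymm (not_lt.1 (hemp hi)) (hxs.1 i)
      · exact hxs.2.2.1 i hi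
    have h1 := hxs.2.2.2
    rw [h0] at h1
    have : (1 : ℝ) ≤ k := by exact_mod_cast hk
    linarith
  obtain ⟨j₀, hj₀, hmax⟩ := Finset.exists_max_image _
    (fun j => g (EuclideanSpace.single j 1)) hne
  rw [Finset.mem_filter] at hj₀
  refine ⟨_, ⟨j₀, hj₀.1, rfl⟩, fun i hi hlt => ?_, fun j hj hlt => ?_⟩
  · by_contra hne1
    exact absurd (hex i hi j₀ hj₀.1 (lt_of_le_of_ne (hxs.2.1 i) hne1) hj₀.2) (not_le.2 hlt)
  · by_contra hne0
    have : j ∈ J.filter fun j => 0 < x j :=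
      Finset.mem_filter.2 ⟨hj, lt_of_le_of_ne (hxs.1 j) (Ne.symm hne0)⟩
    exact absurd (hmax j this) (not_le.2 hlt)

/-- The point with all entries `k / |J|` can move along every `e_i - e_j` with `i, j ∈ J`, so a
functional vanishing on the span is constant on the `a_j`, against spanning of the lifted points. -/
theorem vectorSpan_proj_hypersimplex (hk : 1 ≤ k) (hkJ : k < J.card)
    (hspan : Submodule.span ℝ (lifted a '' J) = ⊤) :
    vectorSpan ℝ (proj a '' hypersimplex J k) = ⊤ := by
  by_contra hne
  obtain ⟨ψ, hψ, hle⟩ := Submodule.exists_le_ker_of_lt_top _ (lt_top_iff_ne_top.2 hne)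
  have hJ0 : (0 : ℝ) < J.card := by exact_mod_cast (show 0 < J.card by omega)
  have hk0 : (0 : ℝ) < k := by exact_mod_cast hk
  have hkJ' : (k : ℝ) < J.card := by exact_mod_cast hkJ
  set x : EuclideanSpace ℝ (Fin n) := WithLp.toLp 2 fun j =>
    if j ∈ J then (k : ℝ) / J.card else 0 with hx
  have hxJ : ∀ j, x j = if j ∈ J then (k : ℝ) / J.card else 0 := fun j => rfl
  have hpos : ∀ j ∈ J, 0 < x j := fun j hj => by rw [hxJ, if_pos hj]; positivity
  have hlt : ∀ j, x j < 1 := fun j => by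
    rw [hxJ]; split_ifs
    · rwa [div_lt_one hJ0]
    · exact one_pos
  have hxs : x ∈ slice J k := by
    refine ⟨fun i => ?_, fun i => (hlt i).le, fun i hi => ?_, ?_⟩
    · rw [hxJ]; split_ifs <;> positivity
    · rw [hxJ, if_neg hi]
    · simp only [hxJ, Finset.sum_ite_mem, Finset.univ_inter, Finset.sum_const, nsmul_eq_mul]
      field_simp
  have hconst : ∀ i ∈ J, ∀ j ∈ J, ψ (a i) = ψ (a j) := by
    intro i hi j hj
    rcases eq_or_ne i j with rfl | hij
    · rfl
    obtain ⟨t, ht, hm⟩ := exists_pos_add_smul_mem_slice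
      (c := EuclideanSpace.single i (1 : ℝ) - EuclideanSpace.single j (1 : ℝ)) hxs
      (by simp [Finset.sum_sub_distrib])
      (fun l hl => by
        have h1 : l ≠ i := fun h => hl (h ▸ hi)
        have h2 : l ≠ j := fun h => hl (h ▸ hj)
        simp [h1, h2])
      (fun l hl => by
        by_cases h2 : l = j
        · rw [h2]; exact hpos j hj
        · by_cases h1 : l = i
          · subst h1; simp [h2] at hl; linarith
          · simp [h1, h2] at hl)
      (fun l _ => hlt l)
    rw [← hypersimplex_eq_slice] at hm hxs
    have := hle (vsub_mem_vectorSpan ℝ (Set.mem_image_of_mem (proj a) hm)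
      (Set.mem_image_of_mem (proj a) hxs))
    have hs : ∀ l, proj a (EuclideanSpace.single l 1) = a l := fun l => by
      simp [proj]
    simp only [vsub_eq_sub, map_add, map_smul, map_sub, hs, add_sub_cancel_left, LinearMap.mem_ker,
      smul_eq_mul, mul_eq_zero, ht.ne', false_or, sub_eq_zero] at this
    exact this
  obtain ⟨j₀, hj₀⟩ : J.Nonempty := Finset.card_pos.1 (by omega)
  have hf : ψ ∘ₗ LinearMap.fst ℝ _ _ - ψ (a j₀) • LinearMap.snd ℝ (EuclideanSpace ℝ (Fin d)) ℝ =
      0 := by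
    refine LinearMap.ext_on hspan ?_
    rintro _ ⟨i, hi, rfl⟩
    simp [lifted, hconst i hi j₀ hj₀]
  refine hψ (LinearMap.ext fun v => ?_)
  simpa using LinearMap.congr_fun hf (v, 0)

theorem affineDim_proj_hypersimplex (hk : 1 ≤ k) (hkJ : k < J.card)
    (hspan : Submodule.span ℝ (lifted a '' J) = ⊤) :
    affineDim (proj a '' hypersimplex J k) = d := by
  rw [affineDim, vectorSpan_proj_hypersimplex hk hkJ hspan, finrank_top]
  simp

theorem ae_dual_ne {ψ : Module.Dual ℝ (EuclideanSpace ℝ (Fin d))} (hψ : ψ ≠ 0) (c : ℝ) :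
    ∀ᵐ y ∂(μH[(d : ℝ)] : Measure (EuclideanSpace ℝ (Fin d))), ψ y ≠ c := by
  obtain ⟨v, hv⟩ : ∃ v, ψ v ≠ 0 := by
    by_contra! h; exact hψ (LinearMap.ext h)
  have hH : (μH[(d : ℝ)] : Measure (EuclideanSpace ℝ (Fin d))).IsAddHaarMeasure := by
    have : (d : ℝ) = (Module.finrank ℝ (EuclideanSpace ℝ (Fin d)) : ℝ) := by simp
    rw [this]; infer_instance
  have hker : LinearMap.ker ψ ≠ ⊤ := fun h => hψ (LinearMap.ker_eq_top.1 h)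
  have h0 := Measure.addHaar_submodule (μH[(d : ℝ)] : Measure (EuclideanSpace ℝ (Fin d))) _ hker
  rw [← measure_preimage_add_right _ (-((c / ψ v) • v))] at h0
  refine measure_mono_null (fun y hy => ?_) h0
  have hy : ψ y = c := by simpa using hy
  simp [hy, hv]

/-- For a spanning configuration, minimality on all fibers can be checked at the vertices of the
hyperplane arrangement. -/
theorem isFiberMin_of_forall_signCompatible (hd : 0 < d) (hk : 1 ≤ k) (hkJ : k ≤ J.card)
    (hspan : Submodule.span ℝ (lifted a '' J) = ⊤)
    (h : ∀ p, Submodule.span ℝ (lifted a '' {j | j ∈ J ∧ height a w p j = 0}) = ⊤ →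
      (J.filter fun j => height a w p j < 0).card < k →
      k < (J.filter fun j => height a w p j ≤ 0).card → ∃ q, SignCompatible a J w u p q) :
    ∀ x, IsFiberMin (proj a) (hypersimplex J k) w x →
      IsFiberMin (proj a) (hypersimplex J k) u x := by
  classical
  -- At `k = |J|` the hypersimplex is a single point.
  rcases hkJ.eq_or_lt with rfl | hkJ'
  · intro x hx
    refine ⟨hx.1, fun y hy _ => ?_⟩
    have hs := slice_card_subsingleton J
    rw [← hypersimplex_eq_slice] at hs
    rw [hs hy hx.1]
  have hQ : IsPolytope (hypersimplex J k) := isPolytope_hypersimplex hkJ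
  -- Almost every fiber suffices: pass to the inclusion of faces of the fiber polytope and back to
  -- all fibers.
  suffices hae : ∀ᵐ y ∂(μH[(affineDim (proj a '' hypersimplex J k) : ℝ)] :
      Measure (EuclideanSpace ℝ (Fin d))).restrict (proj a '' hypersimplex J k),
      ∀ x, proj a x = y → IsFiberMin (proj a) (hypersimplex J k) w x →
        IsFiberMin (proj a) (hypersimplex J k) u x from
    fun x hx => hQ.isFiberMin_of_faceOf_fiberPolytope_subset (hQ.faceOf_fiberPolytope_subset hae) hx
  rw [affineDim_proj_hypersimplex hk hkJ' hspan]
  refine ae_restrict_of_ae ?_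
  -- Two genericity conditions: `y` is no image of a 0/1 point, and, by `hhyp`, it avoids the
  -- finitely many hyperplanes coming from non-spanning sets `Z` of zero heights.
  have hpt : ∀ᵐ y ∂(μH[(d : ℝ)] : Measure (EuclideanSpace ℝ (Fin d))),
      ∀ S : Finset (Fin n), y ≠ ∑ i ∈ S, a i := by
    rw [ae_all_iff]
    intro S
    have := Measure.nullSingletonClass_hausdorff (X := EuclideanSpace ℝ (Fin d)) (d := (d : ℝ))
      (by exact_mod_cast hd)
    exact Measure.ae_ne _ _
  have hhyp : ∀ᵐ y ∂(μH[(d : ℝ)] : Measure (EuclideanSpace ℝ (Fin d))),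
      ∀ Z I : Finset (Fin n), Submodule.span ℝ (lifted a '' Z) ≠ ⊤ →
        ∃ f : Module.Dual ℝ (EuclideanSpace ℝ (Fin d) × ℝ), f ≠ 0 ∧
          (∀ i ∈ Z, f (lifted a i) = 0) ∧
          (f ∘ₗ LinearMap.inl ℝ _ _ ≠ 0 → f (y, k) ≠ f (∑ i ∈ I, lifted a i)) := by
    rw [ae_all_iff]
    intro Z
    rw [ae_all_iff]
    intro I
    by_cases hZ : Submodule.span ℝ (lifted a '' (Z : Set (Fin n))) = ⊤
    · simp [hZ]
    obtain ⟨f, hf0, hfZ⟩ := Submodule.exists_le_ker_of_lt_top _ (lt_top_iff_ne_top.2 hZ)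
    have hfZ' : ∀ i ∈ Z, f (lifted a i) = 0 := fun i hi =>
      hfZ (Submodule.subset_span ⟨i, hi, rfl⟩)
    by_cases hf : f ∘ₗ LinearMap.inl ℝ _ _ = 0
    · exact Filter.Eventually.of_forall fun y _ => ⟨f, hf0, hfZ', fun h => absurd hf h⟩
    · filter_upwards [ae_dual_ne hf (f (∑ i ∈ I, lifted a i) - f (0, (k : ℝ)))] with y hy _
      refine ⟨f, hf0, hfZ', fun _ he => hy ?_⟩
      rw [← he, ← map_sub]
      simp
  filter_upwards [hpt, hhyp] with y hypt hyhyp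
  rintro x rfl hx
  obtain ⟨ψ, x', hx', hxx'⟩ := hQ.exists_mem_faceOf_add_comp (π := proj a) w
    (Set.mem_image_of_mem (proj a) hx.1)
  have hxf := hx.mem_faceOf hx' hxx'
  obtain ⟨c, ⟨j₀, hj₀, hc⟩, hlow, hhigh⟩ := exists_threshold hk hxf
  -- The threshold `c` is the multiplier of the constraint on the coordinate sum.
  set p : Module.Dual ℝ (EuclideanSpace ℝ (Fin d) × ℝ) :=
    ψ ∘ₗ LinearMap.fst ℝ _ _ - c • LinearMap.snd ℝ _ _ with hp
  have hheight : ∀ j, height a w p j =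
      (w + ψ ∘ₗ proj a) (EuclideanSpace.single j 1) - c := by
    intro j
    have hs : proj a (EuclideanSpace.single j 1) = a j := by simp [proj]
    simp [height, hp, lifted, hs]
    ring
  have hlow' : ∀ j ∈ J, height a w p j < 0 → x j = 1 := fun j hj hlt =>
    hlow j hj (by rw [hheight] at hlt; linarith)
  have hhigh' : ∀ j ∈ J, 0 < height a w p j → x j = 0 := fun j hj hlt =>
    hhigh j hj (by rw [hheight] at hlt; linarith)
  have hj₀' : height a w p j₀ = 0 := by rw [hheight, hc, sub_self]
  have hxs : x ∈ slice J k := by rw [← hypersimplex_eq_slice]; exact hx.1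
  set I := J.filter fun j => height a w p j < 0 with hI
  set Z := J.filter fun j => height a w p j = 0 with hZ
  have hIZ : (J.filter fun j => height a w p j ≤ 0) = I ∪ Z := by
    rw [hI, hZ, ← Finset.filter_or]
    simp only [le_iff_lt_or_eq]
  have hdisj : Disjoint I Z := Finset.disjoint_filter.2 fun j _ h1 h2 => h1.ne h2
  have hsplit : ∀ {M : Type} [AddCommGroup M] [Module ℝ M] (g : Fin n → M),
      ∑ i, x i • g i = ∑ i ∈ I, g i + ∑ i ∈ Z, x i • g i := by
    intro M _ _ g
    have h1 : ∑ i ∈ I, g i = ∑ i ∈ I, x i • g i := Finset.sum_congr rfl fun i hi => by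
      rw [Finset.mem_filter] at hi
      rw [hlow' i hi.1 hi.2, one_smul]
    rw [h1, ← Finset.sum_union hdisj]
    refine (Finset.sum_subset (Finset.subset_univ _) fun i _ hi => ?_).symm
    suffices x i = 0 by rw [this, zero_smul]
    by_cases hiJ : i ∈ J
    · refine hhigh' i hiJ ?_
      rw [← hIZ, Finset.mem_filter, not_and, not_le] at hi
      exact hi hiJ
    · exact hxs.2.2.1 i hiJ
  have hproj : proj a x = ∑ i ∈ I, a i + ∑ i ∈ Z, x i • a i := hsplit a
  have hsum : (k : ℝ) = I.card + ∑ i ∈ Z, x i := by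
    have := hsplit (fun _ => (1 : ℝ))
    simpa [hxs.2.2.2] using this
  have hlift : (proj a x, (k : ℝ)) = ∑ i ∈ I, lifted a i + ∑ i ∈ Z, x i • lifted a i := by
    rw [← hsplit (lifted a), sum_smul_lifted, hxs.2.2.2]
  have hspanZ : Submodule.span ℝ (lifted a '' Z) = ⊤ := by
    by_contra hne
    obtain ⟨f, hf0, hfZ, hfy⟩ := hyhyp Z I hne
    have he : f (proj a x, (k : ℝ)) = f (∑ i ∈ I, lifted a i) := by
      rw [hlift, map_add, map_sum f (fun i => x i • lifted a i) Z]
      rw [Finset.sum_eq_zero (s := Z) fun i hi => by rw [map_smul, hfZ i hi, smul_zero], add_zero]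
    -- Genericity leaves only an `f` depending on the last coordinate; it must vanish since the
    -- threshold is attained at `j₀ ∈ Z`, whose lifted point has last coordinate 1.
    have hinl : f ∘ₗ LinearMap.inl ℝ _ _ = 0 := by
      by_contra hne'
      exact hfy hne' he
    have h1 : ∀ v, f (v, 0) = 0 := fun v => by simpa using LinearMap.congr_fun hinl v
    have h2 : f (0, 1) = 0 := by
      have h3 := hfZ j₀ (Finset.mem_filter.2 ⟨hj₀, hj₀'⟩)
      have h4 : lifted a j₀ = (a j₀, 0) + (0, 1) := by simp [lifted]
      rwa [h4, map_add, h1, zero_add] at h3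
    refine hf0 (LinearMap.ext fun v => ?_)
    have h5 : v = (v.1, 0) + v.2 • (0, 1) := by ext1 <;> simp
    rw [h5, map_add, map_smul, h1, h2]
    simp
  have hZset : (Z : Set (Fin n)) = {j | j ∈ J ∧ height a w p j = 0} := by
    ext j; simp [hZ]
  have hZ0 : 0 ≤ ∑ i ∈ Z, x i := Finset.sum_nonneg fun i _ => hxs.1 i
  -- Equality would make `x` the indicator of `I`, and in `hm` that of `I ∪ Z`; both are excluded by
  -- `hypt`.
  have hl : I.card < k := by
    have hle : (I.card : ℝ) ≤ k := by linarith
    refine lt_of_le_of_ne (by exact_mod_cast hle) fun he => hypt I ?_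
    have h0 : ∑ i ∈ Z, x i = 0 := by rw [← he] at hsum; linarith
    rw [Finset.sum_eq_zero_iff_of_nonneg fun i _ => hxs.1 i] at h0
    rw [hproj, Finset.sum_eq_zero (s := Z) fun i hi => by rw [h0 i hi, zero_smul], add_zero]
  have hm : k < (J.filter fun j => height a w p j ≤ 0).card := by
    rw [hIZ, Finset.card_union_of_disjoint hdisj]
    have hle : ∑ i ∈ Z, x i ≤ Z.card := by
      simpa using Finset.sum_le_sum fun i (_ : i ∈ Z) => hxs.2.1 i
    have hle' : (k : ℝ) ≤ (I.card + Z.card : ℕ) := by push_cast; linarith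
    refine lt_of_le_of_ne (by exact_mod_cast hle') fun he => hypt (I ∪ Z) ?_
    have h0 : ∑ i ∈ Z, (1 - x i) = 0 := by
      rw [he] at hsum; push_cast at hsum
      simp only [Finset.sum_sub_distrib, Finset.sum_const, nsmul_eq_mul, mul_one]
      linarith
    rw [Finset.sum_eq_zero_iff_of_nonneg fun i _ => sub_nonneg.2 (hxs.2.1 i)] at h0
    rw [hproj, Finset.sum_union hdisj]
    congr 1
    refine Finset.sum_congr rfl fun i hi => ?_
    rw [← sub_eq_zero.1 (h0 i hi), one_smul]
  obtain ⟨q, hq⟩ := h p (hZset ▸ hspanZ) hl hm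
  refine isFiberMin_of_height (p := q) hx.1 (fun j hj hpos => ?_) (fun j hj hneg => ?_)
  · refine hhigh' j hj ?_
    by_contra hle
    rcases (not_lt.1 hle).lt_or_eq with h1 | h1
    · exact absurd ((hq j hj).2.2 h1) (not_le.2 hpos)
    · exact hpos.ne' ((hq j hj).1 h1)
  · refine hlow' j hj ?_
    by_contra hle
    rcases (not_lt.1 hle).lt_or_eq with h1 | h1
    · exact absurd ((hq j hj).2.1 h1) (not_le.2 hneg)
    · exact hneg.ne ((hq j hj).1 h1.symm)

end Generic

/-! ### Passing between consecutive levels. -/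

section Levels

variable {n d : ℕ} {a : Fin n → EuclideanSpace ℝ (Fin d)}
  {w u : Module.Dual ℝ (EuclideanSpace ℝ (Fin n))}
  {p q : Module.Dual ℝ (EuclideanSpace ℝ (Fin d) × ℝ)} {J : Finset (Fin n)} {k : ℕ}
  {B : Finset (Fin n)} {β : Fin n → Module.Dual ℝ (EuclideanSpace ℝ (Fin d) × ℝ)}

/-- Minimality for `w` on a fiber of the hypersimplex implies minimality for `u`. -/
def FiberDominates (a : Fin n → EuclideanSpace ℝ (Fin d)) (J : Finset (Fin n)) (k : ℕ)
    (w u : Module.Dual ℝ (EuclideanSpace ℝ (Fin n))) : Prop :=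
  ∀ x, IsFiberMin (proj a) (hypersimplex J k) w x → IsFiberMin (proj a) (hypersimplex J k) u x

/-- The bridge from polytopes to linear programs; afterwards only fiberwise minimality is used. -/
theorem faceOf_hypersecondary_subset_iff (hk : k ≤ J.card) :
    faceOf (hypersecondary a J k) w ⊆ faceOf (hypersecondary a J k) u ↔
      FiberDominates a J k w u := by
  have hQ := isPolytope_hypersimplex hk
  constructor
  · intro h x hx
    exact hQ.isFiberMin_of_faceOf_fiberPolytope_subset h hx
  · intro h
    exact hQ.faceOf_fiberPolytope_subset (Filter.Eventually.of_forall fun y x _ => h x)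

/-- At a vertex of the arrangement lying on exactly `d + 1` hyperplanes and below all others,
compatibility follows from the minimality on level `d + 1`. -/
theorem height_nonneg_of_fiberDominates (hK : FiberDominates a J k w u) (hk : 2 ≤ k)
    (hBJ : B ⊆ J) (hcard : B.card = k)
    (hββ : ∀ i ∈ B, ∀ j ∈ B, β i (lifted a j) = if i = j then 1 else 0)
    (hβ : ∀ v, v = ∑ i ∈ B, β i v • lifted a i)
    (hp : ∀ i ∈ B, height a w p i = 0) (hpos : ∀ j ∈ J, j ∉ B → 0 < height a w p j)
    (hq : ∀ i ∈ B, height a u q i = 0) : ∀ j ∈ J, j ∉ B → 0 ≤ height a u q j := by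
  classical
  intro j hj hjB
  have hsum1 : ∑ i ∈ B, β i (lifted a j) = 1 := by
    have := congrArg Prod.snd (hβ (lifted a j))
    simpa [lifted, Prod.snd_sum] using this.symm
  obtain ⟨b, hb, hbj⟩ : ∃ b ∈ B, 0 < β b (lifted a j) := by
    by_contra! hcon
    have := Finset.sum_nonpos hcon
    linarith
  have hne : (J.filter fun l => l ∉ B ∧ 0 < β b (lifted a l)).Nonempty :=
    ⟨j, Finset.mem_filter.2 ⟨hj, hjB, hbj⟩⟩
  -- The ratio test of a simplex pivot: `p` moves along `-β b`, which pushes `b` below zero and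
  -- fixes the other basis heights, until the first outside height vanishes, at `s`. The new vertex
  -- `p'` has one negative and at least `k + 1` nonpositive heights.
  obtain ⟨s, hs, hmin⟩ := Finset.exists_min_image _
    (fun l => height a w p l / β b (lifted a l)) hne
  obtain ⟨hsJ, hsB, hbs⟩ := Finset.mem_filter.1 hs
  set t := height a w p s / β b (lifted a s) with ht
  have ht0 : 0 < t := div_pos (hpos s hsJ hsB) hbs
  set p' := p - t • β b with hp'
  have hh : ∀ l, height a w p' l = height a w p l - t * β b (lifted a l) := fun l => by
    simp [height, hp']; ring
  have hs0 : height a w p' s = 0 := by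
    rw [hh, ht]; field_simp; ring
  have hB0 : ∀ i ∈ B, i ≠ b → height a w p' i = 0 := fun i hi hib => by
    rw [hh, hp i hi, hββ b hb i hi, if_neg (Ne.symm hib)]; ring
  have hbneg : height a w p' b < 0 := by
    rw [hh, hp b hb, hββ b hb b hb, if_pos rfl]; linarith
  have hout : ∀ l ∈ J, l ∉ B → 0 ≤ height a w p' l := by
    intro l hl hlB
    rw [hh, sub_nonneg]
    rcases lt_or_ge 0 (β b (lifted a l)) with h | h
    · exact (le_div_iff₀ h).1 (hmin l (Finset.mem_filter.2 ⟨hl, hlB, h⟩))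
    · exact (mul_nonpos_of_nonneg_of_nonpos ht0.le h).trans (hpos l hl hlB).le
  have hspan : Submodule.span ℝ (lifted a '' {l | l ∈ J ∧ height a w p' l = 0}) = ⊤ := by
    set S := Submodule.span ℝ (lifted a '' {l | l ∈ J ∧ height a w p' l = 0}) with hS
    have hmem : ∀ l ∈ J, height a w p' l = 0 → lifted a l ∈ S := fun l hl h0 =>
      Submodule.subset_span ⟨l, ⟨hl, h0⟩, rfl⟩
    have hbS : lifted a b ∈ S := by
      have h1 := hβ (lifted a s)
      rw [← Finset.add_sum_erase _ _ hb] at h1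
      have h2 : β b (lifted a s) • lifted a b =
          lifted a s - ∑ i ∈ B.erase b, β i (lifted a s) • lifted a i :=
        eq_sub_of_add_eq h1.symm
      have h3 : β b (lifted a s) • lifted a b ∈ S := by
        rw [h2]
        refine S.sub_mem (hmem s hsJ hs0) (S.sum_mem fun i hi => S.smul_mem _ ?_)
        have hi' := Finset.mem_of_mem_erase hi
        exact hmem i (hBJ hi') (hB0 i hi' (Finset.ne_of_mem_erase hi))
      exact (S.smul_mem_iff hbs.ne').1 h3
    rw [eq_top_iff]
    intro v _
    rw [hβ v]
    refine S.sum_mem fun i hi => S.smul_mem _ ?_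
    by_cases hib : i = b
    · rwa [hib]
    · exact hmem i (hBJ hi) (hB0 i hi hib)
  have hl : (J.filter fun l => height a w p' l < 0).card < k := by
    have : (J.filter fun l => height a w p' l < 0) ⊆ {b} := by
      intro l hl
      rw [Finset.mem_filter] at hl
      rw [Finset.mem_singleton]
      by_contra hlb
      by_cases hlB : l ∈ B
      · exact hl.2.ne (hB0 l hlB hlb)
      · exact absurd hl.2 (not_lt.2 (hout l hl.1 hlB))
    have := Finset.card_le_card this
    rw [Finset.card_singleton] at this
    omega
  have hm : k < (J.filter fun l => height a w p' l ≤ 0).card := by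
    have : insert s B ⊆ J.filter fun l => height a w p' l ≤ 0 := by
      intro l hl
      rw [Finset.mem_filter]
      rcases Finset.mem_insert.1 hl with rfl | hl
      · exact ⟨hsJ, hs0.le⟩
      · by_cases hlb : l = b
        · rw [hlb]; exact ⟨hBJ hb, hbneg.le⟩
        · exact ⟨hBJ hl, (hB0 l hl hlb).le⟩
    have := Finset.card_le_card this
    rw [Finset.card_insert_of_notMem hsB, hcard] at this
    omega
  obtain ⟨q', hq'⟩ := exists_signCompatible hK hspan hl hm
  have hqj : 0 ≤ height a u q' j := by
    rcases (hout j hj hjB).eq_or_lt with h | h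
    · exact ((hq' j hj).1 h.symm).ge
    · exact (hq' j hj).2.1 h
  have hqb : height a u q' b ≤ 0 := (hq' b (hBJ hb)).2.2 hbneg
  have hdiff : ∀ l, height a u q l - height a u q' l = (q - q') (lifted a l) := fun l => by
    simp [height]
  have hval : (q - q') (lifted a j) = β b (lifted a j) * (q - q') (lifted a b) := by
    conv_lhs => rw [hβ (lifted a j), map_sum]
    rw [Finset.sum_eq_single b]
    · simp
    · intro i hi hib
      rw [map_smul, ← hdiff, hq i hi, (hq' i (hBJ hi)).1 (hB0 i hi hib), sub_zero, smul_zero]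
    · exact fun h => absurd hb h
  -- The height of `j` at `q` equals that at `q'` minus `β b (lifted a j)` times the height of `b`
  -- at `q'`; the signs at `q'` make this nonnegative.
  have h1 := hdiff j
  rw [hval, ← hdiff b, hq b hb] at h1
  nlinarith

/-- A point below a spanning family of hyperplane incidences stays below it, by minimality on
level one. -/
theorem height_nonpos_of_fiberDominates (hd : 0 < d) (hK : FiberDominates a J 1 w u)
    (hBJ : B ⊆ J) (hcard : B.card = d + 1)
    (hβ : ∀ v, v = ∑ i ∈ B, β i v • lifted a i)
    (hp : ∀ i ∈ B, height a w p i = 0) (hq : ∀ i ∈ B, height a u q i = 0)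
    {i : Fin n} (hi : i ∈ J) (hneg : height a w p i < 0)
    (hp' : ∀ j ∈ J, j ≠ i → 0 ≤ height a w p j) (hq' : ∀ j ∈ J, j ≠ i → 0 ≤ height a u q j) :
    height a u q i ≤ 0 := by
  have hiB : i ∉ B := fun h => hneg.ne (hp i h)
  have hc0 : (0 : ℝ) < B.card := by exact_mod_cast (show 0 < B.card by omega)
  have hc1 : (1 : ℝ) < B.card := by exact_mod_cast (show 1 < B.card by omega)
  set x₀ : EuclideanSpace ℝ (Fin n) := WithLp.toLp 2 fun j =>
    if j ∈ B then (1 : ℝ) / B.card else 0 with hx₀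
  have hx₀B : ∀ j, x₀ j = if j ∈ B then (1 : ℝ) / B.card else 0 := fun j => rfl
  have hx₀1 : ∀ j, x₀ j < 1 := fun j => by
    rw [hx₀B]; split_ifs
    · rwa [div_lt_one hc0]
    · exact one_pos
  have hx₀s : x₀ ∈ slice J 1 := by
    refine ⟨fun j => ?_, fun j => (hx₀1 j).le, fun j hj => ?_, ?_⟩
    · rw [hx₀B]; split_ifs <;> positivity
    · rw [hx₀B, if_neg fun h => hj (hBJ h)]
    · simp only [hx₀B, Finset.sum_ite_mem, Finset.univ_inter, Finset.sum_const, nsmul_eq_mul]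
      field_simp
      simp
  have hzero : ∀ g : Fin n → ℝ, (∀ j ∈ B, g j = 0) → ∑ j, x₀ j * g j = 0 := by
    intro g hg
    refine Finset.sum_eq_zero fun j _ => ?_
    by_cases hj : j ∈ B
    · rw [hg j hj, mul_zero]
    · rw [hx₀B, if_neg hj, zero_mul]
  have hcirc : ∀ j, j ≠ i → circuit a B β i j ≠ 0 → j ∈ B := by
    intro j hji hne
    by_contra h
    exact hne (by rw [circuit_apply, if_neg hji, if_neg h, sub_zero])
  obtain ⟨hcπ, hcs⟩ := proj_circuit hβ i
  -- From the barycenter of `B`, moving along the circuit of `i` makes the reduced cost negative.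
  -- Every minimizer of `w` on this fiber therefore uses `i`; it also minimizes `u`, so its reduced
  -- cost for `u` is at most that of the barycenter, which is zero.
  obtain ⟨t, ht, hm⟩ := exists_pos_add_smul_mem_slice (c := circuit a B β i) hx₀s hcs
    (fun j hj => by
      by_contra h
      by_cases hji : j = i
      · exact hj (hji ▸ hi)
      · exact hj (hBJ (hcirc j hji h)))
    (fun j hj => by
      have hji : j ≠ i := by
        rintro rfl
        rw [circuit_apply, if_pos rfl, if_neg hiB] at hj
        linarith
      rw [hx₀B, if_pos (hcirc j hji hj.ne)]
      positivity)
    (fun j _ => hx₀1 j)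
  have hQ : IsPolytope (hypersimplex J 1) :=
    isPolytope_hypersimplex (Finset.card_pos.2 ⟨i, hi⟩)
  rw [← hypersimplex_eq_slice] at hx₀s hm
  obtain ⟨ψ, x, hx, hxx₀⟩ := hQ.exists_mem_faceOf_add_comp (π := proj a) w
    (Set.mem_image_of_mem (proj a) hx₀s)
  have hxw := isFiberMin_of_mem_faceOf hx
  have hxu := hK x hxw
  have hxs : x ∈ slice J 1 := by rw [← hypersimplex_eq_slice]; exact hx.1
  have hx₀s' : x₀ ∈ slice J 1 := by rwa [← hypersimplex_eq_slice]
  have hle : ∀ (g : Module.Dual ℝ (EuclideanSpace ℝ (Fin n)))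
      (r : Module.Dual ℝ (EuclideanSpace ℝ (Fin d) × ℝ)) (y : EuclideanSpace ℝ (Fin n)),
      y ∈ slice J 1 → proj a y = proj a x → g x ≤ g y →
      ∑ j, x j * height a g r j ≤ ∑ j, y j * height a g r j := by
    intro g r y hy hyx hg
    rw [sum_mul_height, sum_mul_height, hyx, hy.2.2.2, hxs.2.2.2]
    linarith
  have hwlt : ∑ j, x j * height a w p j < 0 := by
    have h1 := hle w p (x₀ + t • circuit a B β i) (by rwa [← hypersimplex_eq_slice])
      (by simp [hcπ, hxx₀]) (hxw.2 _ hm (by simp [hcπ, hxx₀]))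
    have h2 : ∑ j, (x₀ + t • circuit a B β i) j * height a w p j = t * height a w p i := by
      simp only [PiLp.add_apply, PiLp.smul_apply, smul_eq_mul, add_mul, Finset.sum_add_distrib,
        mul_assoc, ← Finset.mul_sum]
      rw [hzero _ hp, zero_add, sum_mul_height, hcπ, hcs, Prod.mk_zero_zero, map_zero, add_zero,
        apply_circuit hβ hp]
    rw [h2] at h1
    exact h1.trans_lt (mul_neg_of_pos_of_neg ht hneg)
  have hxi : 0 < x i := by
    refine lt_of_le_of_ne (hxs.1 i) fun h0 => absurd hwlt (not_lt.2 ?_)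
    refine Finset.sum_nonneg fun j _ => ?_
    by_cases hj : j ∈ J
    · by_cases hji : j = i
      · rw [hji, ← h0, zero_mul]
      · exact mul_nonneg (hxs.1 j) (hp' j hj hji)
    · rw [hxs.2.2.1 j hj, zero_mul]
  have hule : ∑ j, x j * height a u q j ≤ 0 := by
    have h1 := hle u q x₀ hx₀s' hxx₀.symm (hxu.2 _ hx₀s hxx₀.symm)
    rwa [hzero _ hq] at h1
  have hsingle : x i * height a u q i ≤ ∑ j, x j * height a u q j := by
    rw [← Finset.add_sum_erase _ _ (Finset.mem_univ i)]
    refine le_add_of_nonneg_right (Finset.sum_nonneg fun j hj => ?_)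
    by_cases hjJ : j ∈ J
    · exact mul_nonneg (hxs.1 j) (hq' j hjJ (Finset.ne_of_mem_erase hj))
    · rw [hxs.2.2.1 j hjJ, zero_mul]
  by_contra! hcon
  have := mul_pos hxi hcon
  linarith

/-- Level `k + 1` of the whole configuration controls level `k` of every spanning subconfiguration
missing at most one label. -/
theorem FiberDominates.of_succ (hK : FiberDominates a Finset.univ (k + 1) w u)
    (hk : 1 ≤ k) (hkd : k ≤ d) (hkJ : k ≤ J.card) (hJ : Jᶜ.card ≤ 1)
    (hspan : Submodule.span ℝ (lifted a '' J) = ⊤) : FiberDominates a J k w u := by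
  classical
  refine isFiberMin_of_forall_signCompatible (by omega) hk hkJ hspan fun p hp hl hm => ?_
  have hsub : {j | j ∈ J ∧ height a w p j = 0} ⊆
      {j | j ∈ (Finset.univ : Finset (Fin n)) ∧ height a w p j = 0} :=
    fun j hj => ⟨Finset.mem_univ j, hj.2⟩
  suffices h : ∃ q, SignCompatible a Finset.univ w u p q by
    obtain ⟨q, hq⟩ := h
    exact ⟨q, fun j _ => hq j (Finset.mem_univ j)⟩
  have hL : ((Finset.univ : Finset (Fin n)).filter fun j => height a w p j < 0).card < k + 1 := by
    have : ((Finset.univ : Finset (Fin n)).filter fun j => height a w p j < 0) ⊆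
        (J.filter fun j => height a w p j < 0) ∪ Jᶜ := by
      intro j hj
      rw [Finset.mem_filter] at hj
      by_cases hjJ : j ∈ J
      · exact Finset.mem_union_left _ (Finset.mem_filter.2 ⟨hjJ, hj.2⟩)
      · exact Finset.mem_union_right _ (Finset.mem_compl.2 hjJ)
    have := (Finset.card_le_card this).trans (Finset.card_union_le _ _)
    omega
  have hM : (J.filter fun j => height a w p j ≤ 0).card ≤
      ((Finset.univ : Finset (Fin n)).filter fun j => height a w p j ≤ 0).card :=
    Finset.card_le_card (Finset.filter_subset_filter _ (Finset.subset_univ J))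
  rcases Nat.lt_or_ge (k + 1)
    ((Finset.univ : Finset (Fin n)).filter fun j => height a w p j ≤ 0).card with h | h
  · refine exists_signCompatible hK ?_ hL h
    exact top_unique (hp ▸ Submodule.span_mono (Set.image_mono hsub))
  -- Here at most `k + 1 ≤ d + 1` heights are nonpositive, while a basis already has `d + 1` zeros.
  -- So `k = d` and all other heights are positive.
  · obtain ⟨B, β, hBS, hcard, hββ, hβ⟩ := exists_dual_basis hp
    obtain ⟨q, hq⟩ := exists_height_eq_zero hββ u
    have hBsub : B ⊆ (Finset.univ : Finset (Fin n)).filter fun j => height a w p j ≤ 0 :=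
      fun j hj => Finset.mem_filter.2 ⟨Finset.mem_univ j, (hBS hj).2.le⟩
    have hBeq := Finset.eq_of_subset_of_card_le hBsub (by omega)
    have hkd' : B.card = k + 1 := by
      have := Finset.card_le_card hBsub
      omega
    have hout : ∀ j, j ∉ B → 0 < height a w p j := by
      intro j hj
      rw [hBeq, Finset.mem_filter, not_and, not_le] at hj
      exact hj (Finset.mem_univ j)
    have hpos := height_nonneg_of_fiberDominates hK (by omega) (Finset.subset_univ B) hkd' hββ hβ
      (fun i hi => (hBS hi).2) (fun j _ hj => hout j hj) hq
    refine ⟨q, fun j _ => ?_⟩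
    by_cases hj : j ∈ B
    · exact ⟨fun _ => hq j hj, fun _ => (hq j hj).ge, fun _ => (hq j hj).le⟩
    · exact ⟨fun h0 => absurd h0 (hout j hj).ne', fun _ => hpos j (Finset.mem_univ j) hj,
        fun h0 => absurd h0 (hout j hj).not_gt⟩

/-- Level `k + 1` of the whole configuration controls level `k` of the deletion of a label whose
deletion is not spanning. -/
theorem FiberDominates.of_succ_erase_of_not_spanning
    (hK : FiberDominates a Finset.univ (k + 1) w u)
    (hspan : Submodule.span ℝ (Set.range (lifted a)) = ⊤) {i : Fin n}
    (hi : Submodule.span ℝ (lifted a '' (Finset.univ.erase i : Finset (Fin n))) ≠ ⊤) :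
    FiberDominates a (Finset.univ.erase i) k w u := by
  classical
  obtain ⟨f, hf0, hf⟩ := Submodule.exists_le_ker_of_lt_top _ (lt_top_iff_ne_top.2 hi)
  have hfj : ∀ j, j ≠ i → f (lifted a j) = 0 := fun j hj =>
    hf (Submodule.subset_span ⟨j, by simpa using hj, rfl⟩)
  have hfi : f (lifted a i) ≠ 0 := by
    intro h
    refine hf0 (LinearMap.ext_on hspan ?_)
    rintro _ ⟨j, rfl⟩
    by_cases hj : j = i
    · rw [hj, h]; rfl
    · rw [hfj j hj]; rfl
  -- The coordinate `x i` is determined by the fiber and the level. Hence the fiber through `x + e`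
  -- lies entirely in `x i = 1`, and subtracting `e` identifies it with a fiber of the deletion.
  have hfsum : ∀ x : EuclideanSpace ℝ (Fin n), f (proj a x, ∑ j, x j) = x i * f (lifted a i) := by
    intro x
    rw [← sum_smul_lifted, map_sum, Finset.sum_eq_single i]
    · simp
    · intro j _ hj
      rw [map_smul, hfj j hj, smul_zero]
    · simp
  set e : EuclideanSpace ℝ (Fin n) := EuclideanSpace.single i 1 with he
  have hei : e i = 1 := by simp [he]
  have hej : ∀ j, j ≠ i → e j = 0 := fun j hj => by simp [he, hj]
  have hes : ∑ j, e j = 1 := by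
    rw [Finset.sum_eq_single i (fun j _ hj => hej j hj) (by simp), hei]
  have hadd : ∀ x ∈ slice (Finset.univ.erase i) k, x + e ∈ slice Finset.univ (k + 1) := by
    rintro x ⟨h0, h1, h2, h3⟩
    have hxi : x i = 0 := h2 i (by simp)
    refine ⟨fun j => ?_, fun j => ?_, fun j hj => absurd (Finset.mem_univ j) hj, ?_⟩
    · by_cases hj : j = i
      · subst hj; simp [hxi, hei]
      · simpa [hej j hj] using h0 j
    · by_cases hj : j = i
      · subst hj; simp [hxi, hei]
      · simpa [hej j hj] using h1 j
    · simp [Finset.sum_add_distrib, h3, hes]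
  have hsub : ∀ x ∈ slice (Finset.univ.erase i) k, ∀ y ∈ slice Finset.univ (k + 1),
      proj a y = proj a (x + e) → y - e ∈ slice (Finset.univ.erase i) k := by
    rintro x hx y hy hyx
    have hxe := hadd x hx
    have h1 := hfsum y
    have h2 := hfsum (x + e)
    rw [hy.2.2.2] at h1
    rw [hxe.2.2.2, ← hyx, h1] at h2
    have h3 := mul_right_cancel₀ hfi h2
    have hxi : x i = 0 := hx.2.2.1 i (by simp)
    have hyi : y i = 1 := by rw [h3]; simp [hxi, hei]
    refine ⟨fun j => ?_, fun j => ?_, fun j hj => ?_, ?_⟩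
    · by_cases hj : j = i
      · subst hj; simp [hyi, hei]
      · simpa [hej j hj] using hy.1 j
    · by_cases hj : j = i
      · subst hj; simp [hyi, hei]
      · simpa [hej j hj] using hy.2.1 j
    · have : j = i := by simpa using hj
      subst this
      simp [hyi, hei]
    · simp [Finset.sum_sub_distrib, hy.2.2.2, hes]
  intro x hx
  simp only [IsFiberMin, FiberDominates, hypersimplex_eq_slice] at hK hx ⊢
  have hxu := hK (x + e) ⟨hadd x hx.1, fun y hy hyx => by
    have := hx.2 (y - e) (hsub x hx.1 y hy hyx) (by rw [map_sub, hyx, map_add, add_sub_cancel_right])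
    rw [map_sub] at this
    rw [map_add]
    linarith⟩
  refine ⟨hx.1, fun y hy hyx => ?_⟩
  have := hxu.2 (y + e) (hadd y hy) (by rw [map_add, map_add, hyx])
  simpa using this

/-- Level `k` of all deletions, together with level `k` of the whole configuration unless there are
more than `d + 2` points, controls level `k + 1`. -/
theorem FiberDominates.succ (hk : 1 ≤ k) (hkd : k ≤ d)
    (hspan : Submodule.span ℝ (Set.range (lifted a)) = ⊤)
    (hdel : ∀ i, FiberDominates a (Finset.univ.erase i) k w u)
    (h : d + 2 < n ∨ FiberDominates a Finset.univ k w u) :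
    FiberDominates a Finset.univ (k + 1) w u := by
  classical
  have hspan' : Submodule.span ℝ (lifted a '' (Finset.univ : Finset (Fin n))) = ⊤ := by
    simpa using hspan
  have hn : d + 1 ≤ n := by
    obtain ⟨B, -, -, hc, -⟩ := exists_dual_basis hspan'
    rw [← hc]
    exact (Finset.card_le_univ B).trans (by simp)
  refine isFiberMin_of_forall_signCompatible (by omega) (by omega)
    (by rw [Finset.card_univ, Fintype.card_fin]; omega) hspan' fun p hp hl hm => ?_
  obtain ⟨B, β, hBS, hcard, hββ, hβ⟩ := exists_dual_basis hp
  obtain ⟨q, hq⟩ := exists_height_eq_zero hββ u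
  have hp0 : ∀ i ∈ B, height a w p i = 0 := fun i hi => (hBS hi).2
  -- A basis avoiding `i` survives the deletion and determines the functional, so all these
  -- deletions yield the same `q`.
  have hdelete : ∀ i ∉ B, ((Finset.univ.erase i).filter fun j => height a w p j < 0).card < k →
      SignCompatible a (Finset.univ.erase i) w u p q := by
    intro i hiB hli
    have hBi : ∀ j ∈ B, j ∈ Finset.univ.erase i := fun j hj =>
      Finset.mem_erase.2 ⟨fun h => hiB (h ▸ hj), Finset.mem_univ j⟩
    have hmi : k < ((Finset.univ.erase i).filter fun j => height a w p j ≤ 0).card := by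
      rw [Finset.filter_erase]
      have := Finset.pred_card_le_card_erase (a := i)
        (s := (Finset.univ : Finset (Fin n)).filter fun j => height a w p j ≤ 0)
      omega
    obtain ⟨q', hq'⟩ := exists_signCompatible (hdel i)
      (span_lifted_eq_top_of_dual_basis hβ fun j hj => ⟨hBi j hj, hp0 j hj⟩) hli hmi
    have : q' = q := eq_of_height_eq_on_spanning (u := u)
      (span_lifted_eq_top_of_dual_basis hβ (subset_refl (B : Set (Fin n))))
      fun j hj => by rw [hq j hj, (hq' j (hBi j hj)).1 (hp0 j hj)]
    rwa [← this]
  have hother : d + 2 < n → ∀ j, ∃ i ∉ B, i ≠ j := by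
    intro hn' j
    obtain ⟨i, hi⟩ : (Finset.univ \ insert j B).Nonempty := by
      rw [← Finset.card_pos, Finset.card_sdiff_of_subset (Finset.subset_univ _), Finset.card_univ,
        Fintype.card_fin]
      have := Finset.card_insert_le j B
      omega
    simp only [Finset.mem_sdiff, Finset.mem_univ, Finset.mem_insert, true_and, not_or] at hi
    exact ⟨i, hi.2, hi.1⟩
  -- With fewer than `k` negative heights, any label off `B` other than `j` may be deleted to test
  -- `j`; with exactly `k`, the deleted label should be negative.
  rcases (Nat.lt_succ_iff.1 hl).lt_or_eq with hlk | hlk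
  · rcases h with hn' | hK
    · refine ⟨q, fun j _ => ?_⟩
      obtain ⟨i, hiB, hij⟩ := hother hn' j
      refine hdelete i hiB (lt_of_le_of_lt (Finset.card_le_card
        (Finset.filter_subset_filter _ (Finset.erase_subset _ _))) hlk) j ?_
      exact Finset.mem_erase.2 ⟨hij.symm, Finset.mem_univ j⟩
    · exact exists_signCompatible hK hp hlk (by omega)
  · set I := (Finset.univ : Finset (Fin n)).filter fun j => height a w p j < 0 with hI
    have hmemI : ∀ i, i ∈ I ↔ height a w p i < 0 := fun i => by simp [hI]
    have hdelI : ∀ i ∈ I, SignCompatible a (Finset.univ.erase i) w u p q := by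
      intro i hi
      refine hdelete i (fun hiB => ((hmemI i).1 hi).ne (hp0 i hiB)) ?_
      rw [Finset.filter_erase, Finset.card_erase_of_mem hi]
      omega
    refine ⟨q, fun j _ => ?_⟩
    -- If `j` is the only negative label, deleting it says nothing about `j` itself. Then `k = 1`,
    -- and minimality on level one gives the missing sign.
    by_cases hex : ∃ i ∈ I, i ≠ j
    · obtain ⟨i, hi, hij⟩ := hex
      exact hdelI i hi j (Finset.mem_erase.2 ⟨hij.symm, Finset.mem_univ j⟩)
    push Not at hex
    have hjI : j ∈ I := by
      obtain ⟨i, hi⟩ : I.Nonempty := Finset.card_pos.1 (by omega)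
      exact hex i hi ▸ hi
    have hk1 : k = 1 := by
      have : I ⊆ {j} := fun i hi => Finset.mem_singleton.2 (hex i hi)
      have := Finset.card_le_card this
      rw [Finset.card_singleton] at this
      omega
    subst hk1
    have hjneg := (hmemI j).1 hjI
    have hwpos : ∀ l, l ≠ j → 0 ≤ height a w p l := by
      intro l hlj
      by_contra! hlt
      exact hlj (hex l ((hmemI l).2 hlt))
    have hupos : ∀ l, l ≠ j → 0 ≤ height a u q l := by
      intro l hlj
      have hc := hdelI j hjI l (Finset.mem_erase.2 ⟨hlj, Finset.mem_univ l⟩)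
      rcases (hwpos l hlj).eq_or_lt with h0 | h0
      · exact (hc.1 h0.symm).ge
      · exact hc.2.1 h0
    have hle : height a u q j ≤ 0 := by
      rcases h with hn' | hK
      · obtain ⟨i, hiB, hij⟩ := hother hn' j
        refine height_nonpos_of_fiberDominates (by omega) (hdel i) ?_ hcard hβ hp0 hq
          (Finset.mem_erase.2 ⟨hij.symm, Finset.mem_univ j⟩) hjneg (fun l _ => hwpos l)
          (fun l _ => hupos l)
        exact fun l hl => Finset.mem_erase.2 ⟨fun h => hiB (h ▸ hl), Finset.mem_univ l⟩
      · exact height_nonpos_of_fiberDominates (by omega) hK (Finset.subset_univ B) hcard hβ hp0 hq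
          (Finset.mem_univ j) hjneg (fun l _ => hwpos l) (fun l _ => hupos l)
    exact ⟨fun h0 => absurd h0 hjneg.ne, fun h0 => absurd h0 hjneg.not_gt, fun _ => hle⟩

/-- A functional vanishing on all lifted points restricts at height one to an affine function
vanishing on the configuration, hence everywhere. -/
theorem span_range_lifted (ha : affineSpan ℝ (Set.range a) = ⊤) :
    Submodule.span ℝ (Set.range (lifted a)) = ⊤ := by
  by_contra hne
  obtain ⟨f, hf0, hf⟩ := Submodule.exists_le_ker_of_lt_top _ (lt_top_iff_ne_top.2 hne)
  let g : EuclideanSpace ℝ (Fin d) →ᵃ[ℝ] ℝ :=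
    (f ∘ₗ LinearMap.inl ℝ _ _).toAffineMap + AffineMap.const ℝ _ (f (0, 1))
  have hg : ∀ v, g v = f (v, 1) := fun v => by
    simp [g, ← map_add]
  have hle : affineSpan ℝ (Set.range a) ≤ (AffineSubspace.mk' (0 : ℝ) ⊥).comap g := by
    rw [affineSpan_le]
    rintro _ ⟨i, rfl⟩
    have : f (lifted a i) = 0 := hf (Submodule.subset_span ⟨i, rfl⟩)
    simp [hg, ← this, lifted]
  rw [ha] at hle
  have hzero : ∀ v, f (v, 1) = 0 := fun v => by
    have := hle (AffineSubspace.mem_top ℝ _ v)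
    simpa [hg] using this
  refine hf0 (LinearMap.ext fun v => ?_)
  have h : v = ((v.1, 1) - (0, 1)) + v.2 • (0, 1) := by ext1 <;> simp
  rw [h, map_add, map_sub, map_smul, hzero, hzero]
  simp

end Levels

end HyperSec

end

/-! ### The two normal equivalences. -/

theorem mainTheorem7 (d n k : ℕ) (a : Fin n → EuclideanSpace ℝ (Fin d))
    (ha : affineSpan ℝ (Set.range a) = ⊤) (hk : 1 ≤ k) (hkd : k ≤ d) :
    (d + 2 < n →
      HyperSec.NormallyEquivalent (HyperSec.hypersecondary a Finset.univ (k + 1))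
        (∑ i : Fin n, HyperSec.hypersecondary a (Finset.univ.erase i) k)) ∧
    HyperSec.NormallyEquivalent (HyperSec.hypersecondary a Finset.univ (k + 1))
      (HyperSec.hypersecondary a Finset.univ k +
        ∑ i : Fin n, HyperSec.hypersecondary a (Finset.univ.erase i) k) := by
  have hspan := HyperSec.span_range_lifted ha
  have hspan' : Submodule.span ℝ (HyperSec.lifted a '' (Finset.univ : Finset (Fin n))) = ⊤ := by
    simpa using hspan
  have hn : d + 1 ≤ n := by
    obtain ⟨B, -, -, hc, -⟩ := HyperSec.exists_dual_basis hspan'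
    rw [← hc]
    exact (Finset.card_le_univ B).trans (by simp)
  have hcard : ∀ i : Fin n, k ≤ (Finset.univ.erase i).card := fun i => by
    rw [Finset.card_erase_of_mem (Finset.mem_univ i), Finset.card_univ, Fintype.card_fin]
    omega
  have hcardn : (Finset.univ : Finset (Fin n)).card = n := by simp
  have hdel : ∀ {w u}, HyperSec.FiberDominates a Finset.univ (k + 1) w u →
      ∀ i, HyperSec.FiberDominates a (Finset.univ.erase i) k w u := by
    intro w u hK i
    by_cases hi : Submodule.span ℝ
        (HyperSec.lifted a '' (Finset.univ.erase i : Finset (Fin n))) = ⊤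
    · refine hK.of_succ hk hkd (hcard i) ?_ hi
      simp
    · exact hK.of_succ_erase_of_not_spanning hspan hi
  have hsum := fun w => HyperSec.faceOf_sum_subset_iff Finset.univ
    (fun i : Fin n => HyperSec.hypersecondary a (Finset.univ.erase i) k)
    (fun i _ => ((HyperSec.isPolytope_hypersimplex (hcard i)).fiberPolytope _).faceOf_nonempty) w
  have hsucc := fun w u => HyperSec.faceOf_hypersecondary_subset_iff (a := a) (w := w) (u := u)
    (J := Finset.univ) (k := k + 1) (by omega)
  have hlow := fun w u => HyperSec.faceOf_hypersecondary_subset_iff (a := a) (w := w) (u := u)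
    (J := Finset.univ) (k := k) (by omega)
  have herase := fun w u i => HyperSec.faceOf_hypersecondary_subset_iff (a := a) (w := w) (u := u)
    (hcard i)
  have hadd : ∀ w u, _ := fun w u => HyperSec.faceOf_add_subset_iff (w := w) (u := u)
    (((HyperSec.isPolytope_hypersimplex (J := Finset.univ) (k := k)
      (by omega)).fiberPolytope (HyperSec.proj a)).faceOf_nonempty w) (hsum w).1
  refine ⟨fun hn' => ⟨?_, ?_⟩, ?_, ?_⟩ <;>
    refine HyperSec.isMinkowskiSummand_of_faceOf_subset fun w u h => ?_
  · rw [hsucc]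
    rw [(hsum w).2 u] at h
    exact HyperSec.FiberDominates.succ hk hkd hspan
      (fun i => (herase w u i).1 (h i (Finset.mem_univ i))) (Or.inl hn')
  · rw [hsucc] at h
    rw [(hsum w).2 u]
    exact fun i _ => (herase w u i).2 (hdel h i)
  · rw [hsucc]
    have h := (hadd w u).1 h
    rw [(hsum w).2 u] at h
    exact HyperSec.FiberDominates.succ hk hkd hspan
      (fun i => (herase w u i).1 (h.2 i (Finset.mem_univ i))) (Or.inr ((hlow w u).1 h.1))
  · rw [hsucc] at h
    refine (hadd w u).2 ⟨(hlow w u).2 (h.of_succ hk hkd (by omega) (by simp) hspan'), ?_⟩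
    rw [(hsum w).2 u]
    exact fun i _ => (herase w u i).2 (hdel h i)
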